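/- **Theorem (Schwarz reflection principle for $H=1/2$ surfaces in $\mathbb{H}^2\times\mathbb{R}$).** Let $\mathbb{L}^4$ be $\mathbb{R}^4$ with the metric $\langle\,,\rangle=-dx_0^2+dx_1^2+dx_2^2+dx_3^2$, and let $\mathbb{H}^2\times\mathbb{R}=\{x\in\mathbb{L}^4 : -x_0^2+x_1^2+x_2^2=-1,\ x_0>0\}$ with the induced Riemannian metric. Let $\Omega\subseteq\mathbb{C}$ be a domain (non-empty, open, connected) which is symmetric, i.e. $\bar z\in\Omega$ for all $z\in\Omega$, and put $\Omega^{\pm}=\Omega\cap\{\pm\operatorname{Im} z>0\}$ and $I=\Omega\cap\mathbb{R}$. Let $\mathcal{P}\subset\mathbb{H}^2\times\mathbb{R}$ be a totally geodesic vertical plane, i.e. $\mathcal P=\gamma\times\mathbb{R}$ with $\gamma$ a complete geodesic of $\mathbb{H}^2$, and let $\sigma$ be the isometric reflection of $\mathbb{H}^2\times\mathbb{R}$ in $\mathcal{P}$. Let $\psi=(N,h):\Omega^+\cup I\to\mathbb{H}^2\times\mathbb{R}$ be a conformal immersion of class $C^2$ (up to $I$), i.e. $\langle d\psi,d\psi\rangle=\lambda|dz|^2$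 with $\lambda>0$, having constant mean curvature $H=1/2$ with respect to a continuous unit normal $\eta$, and with regular vertical projection, i.e. $dN_z:\mathbb{C}\to T_{N(z)}\mathbb{H}^2$ is a linear isomorphism for every $z\in\Omega^+\cup I$. Assume that $\psi(I)\subset\mathcal{P}$ and that $\psi$ meets $\mathcal{P}$ orthogonally along $I$, i.e. $\eta(z)$ is tangent to $\mathcal{P}$ at $\psi(z)$ for every $z\in I$. Then the map $\tilde\psi:\Omega\to\mathbb{H}^2\times\mathbb{R}$, $$\tilde\psi(z)=\begin{cases}\psi(z), & z\in\Omega^+\cup I,\\ \sigma(\psi(\bar z)), & z\in\Omega^-,\end{cases}$$ is a smooth ($C^\infty$) conformal immersion with constant mean curvature $H=1/2$ with respect to a continuous unit normal on $\Omega$ that extends $\eta$. It extends $\psi$ symmetrically across $\mathcal{P}$: $\tilde\psi(\bar z)=\sigma(\tilde\psi(z))$ for all $z\in\Omega$. -/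

import Mathlib

open scoped ContDiff

noncomputable section

namespace H2R

/-- Lorentz-Minkowski 3-space (as a vector space). -/
abbrev L3 : Type := Fin 3 → ℝ

/-- Lorentz-Minkowski 4-space, split as `L3 × ℝ`: the point `(x₀, x₁, x₂, x₃)` is
`((x₀, x₁, x₂), x₃)`. -/
abbrev L4 : Type := L3 × ℝ

/-- The Lorentzian metric `-dx₀² + dx₁² + dx₂²` of `L3`. -/
def lor3 (x y : L3) : ℝ := -(x 0 * y 0) + x 1 * y 1 + x 2 * y 2

/-- The Lorentzian metric `-dx₀² + dx₁² + dx₂² + dx₃²` of `L4`. -/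
def lor4 (x y : L4) : ℝ := lor3 x.1 y.1 + x.2 * y.2

/-- The hyperbolic plane: the upper sheet of the hyperboloid `⟨x, x⟩ = -1` in `L3`. -/
def hyperbolicPlane : Set L3 := {x | lor3 x x = -1 ∧ 0 < x 0}

/-- The Riemannian product `ℍ² × ℝ`, with the metric induced from `L4`. -/
def space : Set L4 := {x | x.1 ∈ hyperbolicPlane}

/-- `ψ` is a conformal immersion on `D` (a set with unique derivatives) into `ℍ² × ℝ`: its
differential is injective and the induced metric is `lam |dz|²` with `lam > 0`. -/
structure IsConformalImmersionOn (D : Set ℂ) (ψ : ℂ → L4) : Prop where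
  mapsTo : Set.MapsTo ψ D space
  immersion : ∀ z ∈ D, Function.Injective (fderivWithin ℝ ψ D z)
  conformal : ∀ z ∈ D, ∃ lam : ℝ, 0 < lam ∧
    ∀ v : ℂ, lor4 (fderivWithin ℝ ψ D z v) (fderivWithin ℝ ψ D z v) = lam * ‖v‖ ^ 2

/-- `η` is a (continuous) unit normal field in `ℍ² × ℝ` of `ψ` on `D`: it is tangent to
`ℍ² × ℝ` (that is, orthogonal to the position vector of the vertical projection), it has length
one, and it is orthogonal to the surface. -/
structure IsUnitNormalOn (D : Set ℂ) (ψ η : ℂ → L4) : Prop where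
  continuousOn : ContinuousOn η D
  tangent : ∀ z ∈ D, lor3 (η z).1 (ψ z).1 = 0
  unit : ∀ z ∈ D, lor4 (η z) (η z) = 1
  normal : ∀ z ∈ D, ∀ v : ℂ, lor4 (fderivWithin ℝ ψ D z v) (η z) = 0

/-- First fundamental form of `ψ` at `z`. -/
def firstForm (D : Set ℂ) (ψ : ℂ → L4) (z v w : ℂ) : ℝ :=
  lor4 (fderivWithin ℝ ψ D z v) (fderivWithin ℝ ψ D z w)

/-- Second fundamental form of `ψ` in `ℍ² × ℝ` at `z` with respect to the unit normal `η`.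
The Levi-Civita connection of `ℍ² × ℝ` is the tangential part of the flat connection of `L4`, so
pairing the flat second derivative with `η`, which is tangent to `ℍ² × ℝ`, gives the same as
pairing the covariant one. -/
def secondForm (D : Set ℂ) (ψ η : ℂ → L4) (z v w : ℂ) : ℝ :=
  lor4 (fderivWithin ℝ (fderivWithin ℝ ψ D) D z v w) (η z)

/-- Mean curvature of `ψ` in `ℍ² × ℝ` at `z` with respect to `η`: half the trace of the second
fundamental form with respect to the first one, in the coordinates `z = s + i t`. -/
def meanCurvature (D : Set ℂ) (ψ η : ℂ → L4) (z : ℂ) : ℝ :=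
  (firstForm D ψ z 1 1 * secondForm D ψ η z Complex.I Complex.I
      - 2 * firstForm D ψ z 1 Complex.I * secondForm D ψ η z 1 Complex.I
      + firstForm D ψ z Complex.I Complex.I * secondForm D ψ η z 1 1)
    / (2 * (firstForm D ψ z 1 1 * firstForm D ψ z Complex.I Complex.I
      - firstForm D ψ z 1 Complex.I ^ 2))

/-- The vertical projection `N : D → ℍ²` of `ψ` is regular: `dN` is a linear isomorphism onto
the tangent plane of `ℍ²` at every point. -/
def HasRegularVerticalProjectionOn (D : Set ℂ) (ψ : ℂ → L4) : Prop :=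
  ∀ z ∈ D, Set.BijOn (fderivWithin ℝ (fun ζ => (ψ ζ).1) D z) Set.univ
    {y : L3 | lor3 y (ψ z).1 = 0}

/-- `p` is a point of `ℍ²` and `w` a unit tangent vector at `p`. -/
def IsUnitTangent (p w : L3) : Prop :=
  p ∈ hyperbolicPlane ∧ lor3 p w = 0 ∧ lor3 w w = 1

/-- The unit speed geodesic of `ℍ²` through `p` with initial velocity `w`. -/
def geodesic (p w : L3) (r : ℝ) : L3 := Real.cosh r • p + Real.sinh r • w

/-- Velocity of `geodesic p w`. -/
def geodesicVelocity (p w : L3) (r : ℝ) : L3 := Real.sinh r • p + Real.cosh r • w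

/-- The totally geodesic vertical plane of `ℍ² × ℝ` over the geodesic through `p` with velocity
`w`. -/
def verticalPlane (p w : L3) : Set L4 := {x | x.1 ∈ Set.range (geodesic p w)}

/-- The tangent space of the vertical plane at its point `x`, spanned by the velocity of the
geodesic and the vertical direction. -/
def verticalPlaneTangent (p w : L3) (x : L4) : Set L4 :=
  {ξ | ∃ r a : ℝ, x.1 = geodesic p w r ∧ ξ.1 = a • geodesicVelocity p w r}

/-- The isometric reflection of `ℍ² × ℝ` in `verticalPlane p w`, as a linear map of `L4`: the
identity on the span of `(p, 0)`, `(w, 0)`, `(0, 1)` and minus the identity on its orthogonal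
complement. -/
def reflection (p w : L3) (x : L4) : L4 :=
  ((2 : ℝ) • (-(lor3 x.1 p) • p + lor3 x.1 w • w) - x.1, x.2)

/-- For `Ω` symmetric with respect to the real axis this is `Ω⁺ ∪ I`, where
`Ω⁺ = Ω ∩ {Im z > 0}` and `I = Ω ∩ ℝ`. -/
def upperPart (Ω : Set ℂ) : Set ℂ := {z | z ∈ Ω ∧ 0 ≤ z.im}

/-- The map equal to `ψ(z)` for `Im z ≥ 0` and to `σ(ψ(z̄))` for `Im z < 0`, with `σ` the
reflection in `verticalPlane p w`. -/
def reflectedExtension (p w : L3) (ψ : ℂ → L4) (z : ℂ) : L4 :=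
  if 0 ≤ z.im then ψ z else reflection p w (ψ (starRingEnd ℂ z))

end H2R

end

noncomputable section

namespace H2R

open MeasureTheory Filter Topology ComplexConjugate Convolution

/-! Two ingredients: the extended surface is `C²` across the real axis, and a `C²` conformal surface
with `H = 1/2` is smooth.

Matching on the axis. In coordinates `z = s + it`, conformality and `H = 1/2` give the equation
`ψ_ss + ψ_tt = λ η + (⟨N_s, N_s⟩ + ⟨N_t, N_t⟩) (N, 0)` (`laplacian_eq`). On `I` the linear map `σ`
fixes `ψ`, hence `ψ_s` and `ψ_ss`; orthogonality to the plane says that it also fixes `η`. The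
vector `ψ_t` is orthogonal to `(N, 0)`, `ψ_s` and `η`, which are all fixed, so `σ` reverses it
(`reflection_eq_neg`), and differentiating along `I` it reverses `ψ_st`. The last second derivative,
`ψ_tt`, is fixed because the equation expresses it through fixed vectors
(`reflection_fderivWithin_I_I`). Hence the 2-jets from the two sides agree, and
`symmExtend_derivatives` gives a `C²` extension. Since `σ` is an isometry, conformality and `H =
1/2` carry over to the lower half, with normal `σ ∘ η ∘ conj` there.

Smoothness. Locally `λ η` is plus or minus the triple product of `(N, 0)`, `ψ_s`, `ψ_t`, so the
equation is a semilinear system `Δψ = Q(ψ, ψ_s, ψ_t)` with smooth `Q`. Putting `φ = ψ_s - i ψ_t`,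
the pair `(ψ, φ)` solves a first order system `∂W/∂z̄ = P(W)`. A `C¹` solution of such a system is
smooth: the Cauchy-Pompeiu formula recovers a cut-off of `W` from its `∂̄`, the Cauchy transform
takes continuous functions of compact support to Hölder functions (`exists_holder_cauchyConv`) and
Hölder functions of compact support to `C¹` functions (`contDiff_cauchyConv`). This yields `C²`, and
the pair `(W, DW)` solves a system of the same type, which starts an induction. -/

/-! ### The regularized Cauchy kernel and the weight `‖ζ‖ ^ (-3/2)` -/

/-- Regularization `conj ζ / (‖ζ‖² + δ)` of the Cauchy kernel `1 / ζ`. -/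
def cauchyReg (δ : ℝ) (ζ : ℂ) : ℂ := (‖ζ‖ ^ 2 + δ)⁻¹ • conj ζ

/-- Real derivative of `cauchyReg δ`. -/
def cauchyRegDeriv (δ : ℝ) (ζ : ℂ) : ℂ →L[ℝ] ℂ :=
  (‖ζ‖ ^ 2 + δ)⁻¹ • (Complex.conjCLE : ℂ →L[ℝ] ℂ)
    + (-((‖ζ‖ ^ 2 + δ) ^ 2)⁻¹ • (2 : ℝ) • innerSL ℝ ζ).smulRight (conj ζ)

theorem cauchyReg_zero (ζ : ℂ) : cauchyReg 0 ζ = ζ⁻¹ := by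
  rw [cauchyReg, add_zero, Complex.inv_def, Complex.normSq_eq_norm_sq, mul_comm, Complex.real_smul]

theorem hasFDerivAt_cauchyReg {δ : ℝ} {ζ : ℂ} (h : ‖ζ‖ ^ 2 + δ ≠ 0) :
    HasFDerivAt (cauchyReg δ) (cauchyRegDeriv δ ζ) ζ := by
  have h1 : HasFDerivAt (fun x : ℂ => ‖x‖ ^ 2 + δ) ((2 : ℝ) • innerSL ℝ ζ) ζ := by
    have := (hasStrictFDerivAt_norm_sq ζ).hasFDerivAt.add_const δ
    exact this.congr_fderiv (by ext; simp [mul_add])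
  have h2 := (hasDerivAt_inv h).comp_hasFDerivAt ζ h1
  have h3 : HasFDerivAt (fun x : ℂ => conj x) (Complex.conjCLE : ℂ →L[ℝ] ℂ) ζ :=
    Complex.conjCLE.hasFDerivAt
  exact h2.smul h3

theorem contDiff_cauchyReg {δ : ℝ} (hδ : 0 < δ) : ContDiff ℝ 1 (cauchyReg δ) := by
  have h : ContDiff ℝ 1 (fun x : ℂ => (‖x‖ ^ 2 + δ)⁻¹) := by
    refine ContDiff.inv ?_ fun x => by positivity
    exact (contDiff_norm_sq ℝ).add contDiff_const
  exact h.smul Complex.conjCLE.contDiff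

theorem norm_cauchyReg_le {δ : ℝ} (hδ : 0 ≤ δ) (ζ : ℂ) : ‖cauchyReg δ ζ‖ ≤ ‖ζ‖⁻¹ := by
  rcases eq_or_ne ζ 0 with rfl | h
  · simp [cauchyReg]
  have hp : 0 < ‖ζ‖ := norm_pos_iff.2 h
  rw [cauchyReg, norm_smul, norm_inv, Real.norm_of_nonneg (by positivity), RCLike.norm_conj,
    inv_mul_le_iff₀ (by positivity)]
  rw [← div_eq_mul_inv, le_div_iff₀ hp]
  nlinarith

theorem norm_cauchyRegDeriv_le {δ : ℝ} (hδ : 0 ≤ δ) {ζ : ℂ} (h : ζ ≠ 0) :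
    ‖cauchyRegDeriv δ ζ‖ ≤ 3 * (‖ζ‖ ^ 2)⁻¹ := by
  have hp : 0 < ‖ζ‖ := norm_pos_iff.2 h
  refine ContinuousLinearMap.opNorm_le_bound _ (by positivity) fun v => ?_
  have h1 : ‖(‖ζ‖ ^ 2 + δ)⁻¹ • conj v‖ ≤ (‖ζ‖ ^ 2)⁻¹ * ‖v‖ := by
    rw [norm_smul, RCLike.norm_conj, Real.norm_of_nonneg (by positivity)]
    gcongr
    linarith
  have h2 : ‖(-((‖ζ‖ ^ 2 + δ) ^ 2)⁻¹ * (2 * inner ℝ ζ v)) • conj ζ‖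
      ≤ 2 * (‖ζ‖ ^ 2)⁻¹ * ‖v‖ := by
    rw [norm_smul, RCLike.norm_conj, norm_mul, norm_neg, norm_mul,
      Real.norm_of_nonneg (by positivity : (0:ℝ) ≤ ((‖ζ‖ ^ 2 + δ) ^ 2)⁻¹)]
    calc ((‖ζ‖ ^ 2 + δ) ^ 2)⁻¹ * (‖(2 : ℝ)‖ * ‖inner ℝ ζ v‖) * ‖ζ‖
        ≤ ((‖ζ‖ ^ 2 + 0) ^ 2)⁻¹ * (2 * (‖ζ‖ * ‖v‖)) * ‖ζ‖ := by
          gcongr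
          · simp
          · exact norm_inner_le_norm ζ v
      _ = 2 * (‖ζ‖ ^ 2)⁻¹ * ‖v‖ := by field_simp; ring
  calc _ = ‖(‖ζ‖ ^ 2 + δ)⁻¹ • conj v + (-((‖ζ‖ ^ 2 + δ) ^ 2)⁻¹ * (2 * inner ℝ ζ v)) • conj ζ‖ := by
        simp [cauchyRegDeriv]
    _ ≤ _ := norm_add_le _ _
    _ ≤ 3 * (‖ζ‖ ^ 2)⁻¹ * ‖v‖ := by linarith

/-- For `δ > 0` the right side is a rescaled fixed bump of constant mass, so as `δ → 0` it is an
approximate identity up to a constant. This is where the Cauchy-Pompeiu formula comes from. -/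
theorem dbar_cauchyReg {δ : ℝ} {ζ : ℂ} (h : ‖ζ‖ ^ 2 + δ ≠ 0) :
    (1 / 2 : ℂ) * (cauchyRegDeriv δ ζ 1 + Complex.I * cauchyRegDeriv δ ζ Complex.I)
      = ((δ / (‖ζ‖ ^ 2 + δ) ^ 2 : ℝ) : ℂ) := by
  have hn : (‖ζ‖ ^ 2 : ℝ) = ζ.re ^ 2 + ζ.im ^ 2 := by
    rw [← Complex.normSq_eq_norm_sq, Complex.normSq_apply]; ring
  obtain ⟨a, ha⟩ : ∃ a, a = ‖ζ‖ ^ 2 + δ := ⟨_, rfl⟩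
  have hδ : δ = a - (ζ.re ^ 2 + ζ.im ^ 2) := by rw [ha, hn]; ring
  rw [← ha] at h
  simp only [cauchyRegDeriv, ← ha]
  apply Complex.ext
  · simp [Complex.inner, -Complex.ofReal_div, -Complex.real_smul, -Complex.ofReal_pow,
      Complex.smul_re, Complex.smul_im]
    field_simp
    rw [hδ]
    ring
  · simp [Complex.inner, -Complex.ofReal_div, -Complex.real_smul, -Complex.ofReal_pow,
      Complex.smul_re, Complex.smul_im]
    field_simp
    ring

theorem tendsto_cauchyReg (ζ : ℂ) {l : Filter ℕ} {d : ℕ → ℝ} (hd : Tendsto d l (𝓝 0)) :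
    Tendsto (fun n => cauchyReg (d n) ζ) l (𝓝 (cauchyReg 0 ζ)) := by
  rcases eq_or_ne ζ 0 with rfl | h
  · simpa [cauchyReg] using tendsto_const_nhds
  refine ((tendsto_const_nhds.add hd).inv₀ ?_).smul_const _
  simpa using h

theorem tendsto_cauchyRegDeriv {ζ : ℂ} (h : ζ ≠ 0) {l : Filter ℕ} {d : ℕ → ℝ}
    (hd : Tendsto d l (𝓝 0)) :
    Tendsto (fun n => cauchyRegDeriv (d n) ζ) l (𝓝 (cauchyRegDeriv 0 ζ)) := by
  have h0 : ‖ζ‖ ^ 2 + 0 ≠ 0 := by simpa using h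
  have h1 : Tendsto (fun n => ‖ζ‖ ^ 2 + d n) l (𝓝 (‖ζ‖ ^ 2 + 0)) := tendsto_const_nhds.add hd
  refine ((h1.inv₀ h0).smul_const _).add ?_
  have h2 : Tendsto (fun n => (-((‖ζ‖ ^ 2 + d n) ^ 2)⁻¹ • (2 : ℝ) • innerSL ℝ ζ)) l
      (𝓝 (-((‖ζ‖ ^ 2 + 0) ^ 2)⁻¹ • (2 : ℝ) • innerSL ℝ ζ)) :=
    (((h1.pow 2).inv₀ (pow_ne_zero 2 h0)).neg).smul_const _
  exact ((ContinuousLinearMap.smulRightL ℝ ℂ ℂ).flip (conj ζ)).continuous.continuousAt.tendsto.comp h2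

/-- The weight `‖ζ‖ ^ (-3/2)`. -/
def weight (ζ : ℂ) : ℝ := (√‖ζ‖ ^ 3)⁻¹

theorem weight_nonneg (ζ : ℂ) : 0 ≤ weight ζ := by unfold weight; positivity

/-- The exponent `-3/2` is that of the differentiated Cauchy kernel, `-2`, improved by the Hölder
exponent `1/2`; this is enough for integrability in the plane. -/
theorem integrableOn_weight (r : ℝ) : IntegrableOn weight (Metric.ball 0 r) := by
  have : IntegrableOn (fun x : ℂ => (fun t : ℝ => (√t ^ 3)⁻¹) ‖x‖) (Metric.ball 0 r) := by
    refine (integrableOn_fun_norm_addHaar volume (f := fun t : ℝ => (√t ^ 3)⁻¹)).2 ?_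
    rcases le_or_gt r 0 with hr | hr
    · simp [Set.Ioo_eq_empty (not_lt.2 hr)]
    -- In polar coordinates the integrand is `t * t ^ (-3/2) = t ^ (-1/2)`.
    refine ((intervalIntegral.integrableOn_Ioo_rpow_iff (s := -(1/2)) hr).2 (by norm_num)).congr_fun
      ?_ measurableSet_Ioo
    intro t ht
    have h0 : 0 < √t := Real.sqrt_pos.2 ht.1
    have h1 : √t * √t = t := Real.mul_self_sqrt ht.1.le
    simp only [Complex.finrank_real_complex, smul_eq_mul]
    rw [Real.rpow_neg ht.1.le, ← Real.sqrt_eq_rpow]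
    field_simp
    norm_num
    nlinarith
  exact this

theorem inv_norm_le_weight {r : ℝ} {ζ : ℂ} (h : ‖ζ‖ ≤ r) : ‖ζ‖⁻¹ ≤ √r * weight ζ := by
  rcases eq_or_ne ζ 0 with rfl | hζ
  · simp [weight]
  have hp : 0 < √‖ζ‖ := Real.sqrt_pos.2 (norm_pos_iff.2 hζ)
  have hs : √‖ζ‖ ^ 2 = ‖ζ‖ := Real.sq_sqrt (norm_nonneg _)
  calc ‖ζ‖⁻¹ = √‖ζ‖ * weight ζ := by
        rw [weight]; nth_rw 1 [← hs]; field_simp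
    _ ≤ √r * weight ζ := by
        gcongr
        exact weight_nonneg _

theorem inv_sq_norm_mul_sqrt (ζ : ℂ) : (‖ζ‖ ^ 2)⁻¹ * √‖ζ‖ = weight ζ := by
  rcases eq_or_ne ζ 0 with rfl | hζ
  · simp [weight]
  have hp : 0 < √‖ζ‖ := Real.sqrt_pos.2 (norm_pos_iff.2 hζ)
  have hs : √‖ζ‖ ^ 2 = ‖ζ‖ := Real.sq_sqrt (norm_nonneg _)
  rw [weight]; nth_rw 1 [← hs]; field_simp

theorem measurable_cauchyReg (δ : ℝ) : Measurable (cauchyReg δ) := by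
  have h : Measurable fun ζ : ℂ => conj ζ := Complex.continuous_conj.measurable
  unfold cauchyReg; fun_prop

theorem integrableOn_inv_norm (r : ℝ) :
    IntegrableOn (fun ζ : ℂ => ‖ζ‖⁻¹) (Metric.ball 0 r) := by
  refine Integrable.mono' ((integrableOn_weight r).const_mul (√r)) (by fun_prop) ?_
  refine (ae_restrict_iff' measurableSet_ball).2 (ae_of_all _ fun ζ hζ => ?_)
  rw [norm_inv, norm_norm]
  exact inv_norm_le_weight (by simpa using (mem_ball_zero_iff.1 hζ).le)

theorem locallyIntegrable_cauchyReg_zero : LocallyIntegrable (cauchyReg 0) := by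
  intro x
  refine ⟨Metric.ball 0 (‖x‖ + 1), Metric.isOpen_ball.mem_nhds (by simp), ?_⟩
  refine Integrable.mono' (integrableOn_inv_norm _)
    (measurable_cauchyReg 0).aestronglyMeasurable (ae_of_all _ fun ζ => ?_)
  exact norm_cauchyReg_le le_rfl ζ

theorem exists_norm_le_of_hasCompactSupport {E : Type*} [NormedAddCommGroup E] {g : ℂ → E} (hg : Continuous g)
    (hc : HasCompactSupport g) : ∃ C, 0 ≤ C ∧ ∀ x, ‖g x‖ ≤ C := by
  obtain ⟨C, hC⟩ := hg.bounded_above_of_compact_support hc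
  exact ⟨C, (norm_nonneg _).trans (hC 0), hC⟩

/-! ### The Cauchy transform and its Hölder continuity -/

section

variable {F : Type*} [NormedAddCommGroup F] [NormedSpace ℝ F] [NormedSpace ℂ F]
  [IsScalarTower ℝ ℂ F]

/-- Convolution with the kernel `1 / ζ`. -/
def cauchyConv (g : ℂ → F) : ℂ → F :=
  cauchyReg 0 ⋆[ContinuousLinearMap.lsmul ℝ ℂ, volume] g

theorem cauchyConv_apply (g : ℂ → F) (z : ℂ) :
    cauchyConv g z = ∫ ζ, cauchyReg 0 ζ • g (z - ζ) := rfl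

theorem cauchyConv_apply_swap (g : ℂ → F) (z : ℂ) :
    cauchyConv g z = ∫ ζ, cauchyReg 0 (z - ζ) • g ζ := by
  rw [cauchyConv_apply, ← integral_sub_left_eq_self _ volume z]
  simp

theorem hasFDerivAt_cauchyConv {g : ℂ → F} (hg : ContDiff ℝ 1 g) (hc : HasCompactSupport g)
    (z : ℂ) : HasFDerivAt (cauchyConv g) (cauchyConv (fderiv ℝ g) z) z := by
  exact hc.hasFDerivAt_convolution_right _ locallyIntegrable_cauchyReg_zero hg z

/-- Write `‖a‖ = s²`, `‖b‖ = t²`. The difference is `‖a - b‖ / (s² t²)`; one factor `√‖a - b‖` is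
kept and the other is at most `s + t`, after which `s t (s + t) ≤ s³ + t³` suffices. If `a` or `b`
is zero, the convention `0⁻¹ = 0` reduces the claim to `inv_norm_le_weight`. -/
theorem norm_inv_sub_inv_le (a b : ℂ) :
    ‖cauchyReg 0 a - cauchyReg 0 b‖ ≤ 2 * √‖a - b‖ * (weight a + weight b) := by
  have hwa := weight_nonneg a
  have hwb := weight_nonneg b
  rcases eq_or_ne a 0 with rfl | ha
  · simp only [cauchyReg_zero, inv_zero, zero_sub, norm_neg, norm_inv]
    refine (inv_norm_le_weight le_rfl).trans ?_
    have := Real.sqrt_nonneg ‖b‖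
    nlinarith [mul_nonneg this hwa, mul_nonneg this hwb]
  rcases eq_or_ne b 0 with rfl | hb
  · simp only [cauchyReg_zero, inv_zero, sub_zero, norm_inv]
    refine (inv_norm_le_weight le_rfl).trans ?_
    have := Real.sqrt_nonneg ‖a‖
    nlinarith [mul_nonneg this hwa, mul_nonneg this hwb]
  rw [cauchyReg_zero, cauchyReg_zero, inv_sub_inv ha hb, norm_div, norm_mul, norm_sub_rev b a]
  obtain ⟨s, hs0, hs⟩ : ∃ s, 0 < s ∧ ‖a‖ = s ^ 2 :=
    ⟨√‖a‖, Real.sqrt_pos.2 (norm_pos_iff.2 ha), (Real.sq_sqrt (norm_nonneg _)).symm⟩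
  obtain ⟨t, ht0, ht⟩ : ∃ t, 0 < t ∧ ‖b‖ = t ^ 2 :=
    ⟨√‖b‖, Real.sqrt_pos.2 (norm_pos_iff.2 hb), (Real.sq_sqrt (norm_nonneg _)).symm⟩
  have hd : √‖a - b‖ ≤ s + t := by
    rw [Real.sqrt_le_left (by positivity)]
    calc ‖a - b‖ ≤ s ^ 2 + t ^ 2 := by rw [← hs, ← ht]; exact norm_sub_le a b
      _ ≤ _ := by nlinarith
  have hdd : ‖a - b‖ = √‖a - b‖ * √‖a - b‖ := (Real.mul_self_sqrt (norm_nonneg _)).symm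
  rw [weight, weight, hs, ht, Real.sqrt_sq hs0.le, Real.sqrt_sq ht0.le]
  calc ‖a - b‖ / (s ^ 2 * t ^ 2) ≤ √‖a - b‖ * (s + t) / (s ^ 2 * t ^ 2) := by
        rw [hdd]; simp only [Real.sqrt_mul_self (Real.sqrt_nonneg _)]; gcongr
    _ = √‖a - b‖ * ((s + t) / (s ^ 2 * t ^ 2)) := by ring
    _ ≤ √‖a - b‖ * (2 * ((s ^ 3)⁻¹ + (t ^ 3)⁻¹)) := by
        gcongr
        rw [div_le_iff₀ (by positivity)]
        have : 2 * ((s ^ 3)⁻¹ + (t ^ 3)⁻¹) * (s ^ 2 * t ^ 2) = 2 * (s ^ 3 + t ^ 3) / (s * t) := by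
          field_simp
          ring
        rw [this, le_div_iff₀ (by positivity)]
        nlinarith [mul_nonneg (add_pos hs0 ht0).le (sq_nonneg (s - t)), pow_pos hs0 3, pow_pos ht0 3]
    _ = _ := by ring

/-- The Cauchy transform of a bounded function with compact support is Hölder continuous. -/
theorem exists_holder_cauchyConv {g : ℂ → F} (hg : Continuous g) (hc : HasCompactSupport g) :
    ∃ C, 0 ≤ C ∧ ∀ z z', ‖cauchyConv g z - cauchyConv g z'‖ ≤ C * √‖z - z'‖ := by
  obtain ⟨M, hM0, hM⟩ := exists_norm_le_of_hasCompactSupport hg hc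
  -- The weight is not integrable at infinity, but outside the unit ball it is at most `1`, and
  -- there the finite measure of the support of `g` takes over.
  set W : ℂ → ℝ := (Metric.ball 0 1).indicator weight with hW
  have hWi : Integrable W := (integrableOn_weight 1).integrable_indicator measurableSet_ball
  have hwW : ∀ x, weight x ≤ W x + 1 := fun x => by
    by_cases hx : x ∈ Metric.ball (0 : ℂ) 1
    · rw [hW, Set.indicator_of_mem hx]; linarith
    · rw [hW, Set.indicator_of_notMem hx, weight, zero_add]
      refine inv_le_one_of_one_le₀ (one_le_pow₀ ?_)
      rw [Real.one_le_sqrt]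
      simpa using hx
  set S : Set ℂ := tsupport g
  have hSfin : volume S < ⊤ := IsCompact.measure_lt_top hc
  set A : ℝ := ∫ x, W x with hA
  have hA0 : 0 ≤ A := integral_nonneg fun x => by
    rw [hW]; exact Set.indicator_nonneg (fun x _ => weight_nonneg x) x
  have hint : ∀ z, Integrable (fun ζ => cauchyReg 0 (z - ζ) • g ζ) := fun z => by
    have h := hc.convolutionExists_right (ContinuousLinearMap.lsmul ℝ ℂ)
      locallyIntegrable_cauchyReg_zero hg z
    have h' := (integrable_comp_sub_left (fun ζ => cauchyReg 0 ζ • g (z - ζ)) z).2 h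
    simpa using h'
  have hWz : ∀ z, Integrable (fun ζ => W (z - ζ)) := fun z => hWi.comp_sub_left z
  refine ⟨2 * M * (2 * A + 2 * volume.real S), by positivity, fun z z' => ?_⟩
  rw [cauchyConv_apply_swap, cauchyConv_apply_swap, ← integral_sub (hint z) (hint z')]
  set s := √‖z - z'‖
  set b : ℂ → ℝ := fun ζ => 2 * M * s * (W (z - ζ) + W (z' - ζ) + S.indicator (fun _ => 2) ζ) with hb
  have hind : Integrable (S.indicator (fun _ : ℂ => (2 : ℝ))) :=
    (integrable_indicator_iff (isClosed_tsupport g).measurableSet).2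
      (integrableOn_const hSfin.ne)
  have hbi : Integrable b := (((hWz z).add (hWz z')).add hind).const_mul _
  have hW0 : ∀ x, 0 ≤ W x := fun x => by
    rw [hW]; exact Set.indicator_nonneg (fun x _ => weight_nonneg x) x
  calc ‖∫ ζ, (cauchyReg 0 (z - ζ) • g ζ - cauchyReg 0 (z' - ζ) • g ζ)‖
      ≤ ∫ ζ, b ζ := by
        refine norm_integral_le_of_norm_le hbi (ae_of_all _ fun ζ => ?_)
        rw [← sub_smul, norm_smul]
        by_cases hζ : ζ ∈ S
        · have h1 := norm_inv_sub_inv_le (z - ζ) (z' - ζ)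
          rw [sub_sub_sub_cancel_right] at h1
          calc _ ≤ 2 * s * (weight (z - ζ) + weight (z' - ζ)) * M := by
                have := weight_nonneg (z - ζ)
                have := weight_nonneg (z' - ζ)
                gcongr
                exact hM ζ
            _ ≤ 2 * s * ((W (z - ζ) + 1) + (W (z' - ζ) + 1)) * M := by
                gcongr <;> exact hwW _
            _ = b ζ := by rw [hb]; simp only [Set.indicator_of_mem hζ]; ring
        · rw [image_eq_zero_of_notMem_tsupport hζ, norm_zero, mul_zero]
          simp only [hb, Set.indicator_of_notMem hζ]
          have := hW0 (z - ζ)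
          have := hW0 (z' - ζ)
          positivity
    _ = 2 * M * s * (A + A + volume.real S * 2) := by
        rw [hb, integral_const_mul, integral_add (f := fun ζ => W (z - ζ) + W (z' - ζ)) ((hWz z).add (hWz z')) hind,
          integral_add (hWz z) (hWz z'), integral_sub_left_eq_self W volume z,
          integral_sub_left_eq_self W volume z',
          integral_indicator_const _ (isClosed_tsupport g).measurableSet, smul_eq_mul]
    _ = _ := by ring

end

/-! ### The Cauchy transform of a Hölder function is continuously differentiable -/

section

/-- Real derivative of `ρ • cauchyReg δ`, where `ρ'` is the derivative of `ρ`. -/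
def cutKernelDeriv (ρ : ℂ → ℝ) (δ : ℝ) (ζ : ℂ) : ℂ →L[ℝ] ℂ :=
  ρ ζ • cauchyRegDeriv δ ζ + (fderiv ℝ ρ ζ).smulRight (cauchyReg δ ζ)

theorem hasFDerivAt_cutKernel {ρ : ℂ → ℝ} (hρ : ContDiff ℝ 1 ρ) {δ : ℝ} (hδ : 0 < δ) (ζ : ℂ) :
    HasFDerivAt (fun ζ => ρ ζ • cauchyReg δ ζ) (cutKernelDeriv ρ δ ζ) ζ :=
  ((hρ.differentiable one_ne_zero ζ).hasFDerivAt).smul (hasFDerivAt_cauchyReg (by positivity))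

theorem contDiff_cutKernel {ρ : ℂ → ℝ} (hρ : ContDiff ℝ 1 ρ) {δ : ℝ} (hδ : 0 < δ) :
    ContDiff ℝ 1 fun ζ => ρ ζ • cauchyReg δ ζ :=
  hρ.smul (contDiff_cauchyReg hδ)

/-- The majorant does not depend on `δ` and is integrable, so it dominates the limit `δ → 0` once a
Hölder increment has supplied the factor `√‖ζ‖`. -/
theorem exists_norm_cutKernelDeriv_le {ρ : ℂ → ℝ} (hρ : ContDiff ℝ 1 ρ) {r : ℝ}
    (hr : tsupport ρ ⊆ Metric.ball 0 r) :
    ∃ B, 0 ≤ B ∧ ∀ δ, 0 ≤ δ → ∀ ζ, ζ ≠ 0 → ‖cutKernelDeriv ρ δ ζ‖ * √‖ζ‖ ≤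
      (Metric.ball 0 r).indicator (fun ζ => B * weight ζ) ζ := by
  have hc : HasCompactSupport ρ :=
    (isCompact_closedBall (0 : ℂ) r).of_isClosed_subset (isClosed_tsupport ρ)
      (hr.trans Metric.ball_subset_closedBall)
  obtain ⟨M, hM0, hM⟩ := exists_norm_le_of_hasCompactSupport hρ.continuous hc
  obtain ⟨M', hM'0, hM'⟩ := exists_norm_le_of_hasCompactSupport
    (hρ.continuous_fderiv one_ne_zero) (hc.fderiv ℝ)
  refine ⟨3 * M + M' * |r|, by positivity, fun δ hδ ζ hζ => ?_⟩
  by_cases hm : ζ ∈ Metric.ball (0 : ℂ) r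
  · rw [Set.indicator_of_mem hm, ← inv_sq_norm_mul_sqrt, ← mul_assoc]
    gcongr
    have hz : 0 < ‖ζ‖ := norm_pos_iff.2 hζ
    have hzr : ‖ζ‖ ≤ |r| := (mem_ball_zero_iff.1 hm).le.trans (le_abs_self r)
    refine (norm_add_le _ _).trans ?_
    rw [norm_smul, ContinuousLinearMap.norm_smulRight_apply]
    calc ‖ρ ζ‖ * ‖cauchyRegDeriv δ ζ‖ + ‖fderiv ℝ ρ ζ‖ * ‖cauchyReg δ ζ‖
        ≤ M * (3 * (‖ζ‖ ^ 2)⁻¹) + M' * (|r| * (‖ζ‖ ^ 2)⁻¹) := by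
          gcongr
          · exact hM ζ
          · exact norm_cauchyRegDeriv_le hδ hζ
          · exact hM' ζ
          · refine (norm_cauchyReg_le hδ ζ).trans ?_
            rw [← div_eq_mul_inv, le_div_iff₀ (by positivity)]
            field_simp
            exact hzr
      _ = _ := by ring
  · have h1 : ζ ∉ tsupport ρ := fun h => hm (hr h)
    have h2 : fderiv ℝ ρ ζ = 0 := fderiv_of_notMem_tsupport ℝ h1
    have h3 : cutKernelDeriv ρ δ ζ = 0 := by
      ext v; simp [cutKernelDeriv, h2, image_eq_zero_of_notMem_tsupport h1]
    rw [Set.indicator_of_notMem hm, h3, norm_zero, zero_mul]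

theorem tendsto_cutKernelDeriv (ρ : ℂ → ℝ) {ζ : ℂ} (h : ζ ≠ 0) {d : ℕ → ℝ}
    (hd : Tendsto d atTop (𝓝 0)) :
    Tendsto (fun n => cutKernelDeriv ρ (d n) ζ) atTop (𝓝 (cutKernelDeriv ρ 0 ζ)) := by
  refine ((tendsto_cauchyRegDeriv h hd).const_smul _).add ?_
  exact ((ContinuousLinearMap.smulRightL ℝ ℂ ℂ (fderiv ℝ ρ ζ)).continuous.tendsto _).comp
    (tendsto_cauchyReg ζ hd)

variable {F : Type*} [NormedAddCommGroup F] [NormedSpace ℝ F] [NormedSpace ℂ F]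
  [IsScalarTower ℝ ℂ F]

/-- The derivative of the kernel has size `‖ζ‖⁻²` and is not absolutely integrable. For `δ > 0` its
integral is zero, so `G (z - ζ)` may be replaced by `G (z - ζ) - G z`, which is `O(√‖ζ‖)`. In this
form the derivatives converge uniformly as `δ → 0`, and a limit of functions with uniformly
convergent derivatives is differentiable with the expected derivative. -/
theorem contDiff_convolution_cutKernel {ρ : ℂ → ℝ} (hρ : ContDiff ℝ 1 ρ) (hc : HasCompactSupport ρ)
    {G : ℂ → F} (hG : Continuous G) (hGc : HasCompactSupport G) {C : ℝ}
    (hh : ∀ x y, ‖G x - G y‖ ≤ C * √‖x - y‖) :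
    ContDiff ℝ 1 ((fun ζ => ρ ζ • cauchyReg 0 ζ) ⋆[ContinuousLinearMap.lsmul ℝ ℂ, volume] G) := by
  obtain ⟨r, hr⟩ : ∃ r, tsupport ρ ⊆ Metric.ball 0 r := hc.isBounded.subset_ball 0
  obtain ⟨B, hB0, hB⟩ := exists_norm_cutKernelDeriv_le hρ hr
  obtain ⟨M, hM0, hM⟩ := exists_norm_le_of_hasCompactSupport hG hGc
  obtain ⟨R, hR0, hR⟩ := exists_norm_le_of_hasCompactSupport hρ.continuous hc
  set L : ℂ →L[ℝ] F →L[ℝ] F := ContinuousLinearMap.lsmul ℝ ℂ with hL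
  set d : ℕ → ℝ := fun n => 1 / ((n : ℝ) + 1) with hd_def
  have hd : Tendsto d atTop (𝓝 0) := tendsto_one_div_add_atTop_nhds_zero_nat
  have hdpos : ∀ n, 0 < d n := fun n => by positivity
  set k : ℕ → ℂ → ℂ := fun n ζ => ρ ζ • cauchyReg (d n) ζ with hk
  have hkc : ∀ n, HasCompactSupport (k n) := fun n => hc.smul_right
  have hk1 : ∀ n, ContDiff ℝ 1 (k n) := fun n => contDiff_cutKernel hρ (hdpos n)
  have hkf : ∀ n, fderiv ℝ (k n) = cutKernelDeriv ρ (d n) := fun n =>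
    funext fun ζ => (hasFDerivAt_cutKernel hρ (hdpos n) ζ).fderiv
  have hkfc : ∀ n, Continuous (cutKernelDeriv ρ (d n)) := fun n => by
    rw [← hkf]; exact (hk1 n).continuous_fderiv one_ne_zero
  have hkfs : ∀ n, HasCompactSupport (cutKernelDeriv ρ (d n)) := fun n => by
    rw [← hkf]; exact (hkc n).fderiv ℝ
  set P := L.precompL ℂ with hP
  have hPb : ∀ A v, ‖P A v‖ ≤ ‖A‖ * ‖v‖ := fun A v => by
    refine ContinuousLinearMap.opNorm_le_bound _ (by positivity) fun x => ?_
    change ‖A x • v‖ ≤ _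
    rw [norm_smul, mul_right_comm]
    gcongr
    exact A.le_opNorm x
  have hne : ∀ᵐ ζ : ℂ, ζ ≠ 0 := by simp [ae_iff]
  -- the derivative of the regularized convolution
  have hzero : ∀ n (v : F), ∫ ζ, P (cutKernelDeriv ρ (d n) ζ) v = 0 := fun n v => by
    -- Convolution with the constant `v` is a constant function, so the integral representing its
    -- derivative is zero.
    have h1 := (hkc n).hasFDerivAt_convolution_left L (hk1 n)
      (continuous_const (y := v)).locallyIntegrable (μ := volume) 0
    have h2 : (k n ⋆[L, volume] fun _ => v) = fun _ => ∫ ζ, L (k n ζ) v := rfl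
    rw [h2] at h1
    have h3 := h1.unique (hasFDerivAt_const _ _)
    rw [hkf] at h3
    exact h3
  have hderiv : ∀ n z, HasFDerivAt (k n ⋆[L, volume] G)
      (∫ ζ, P (cutKernelDeriv ρ (d n) ζ) (G (z - ζ) - G z)) z := fun n z => by
    have h1 := (hkc n).hasFDerivAt_convolution_left L (hk1 n) (hG.locallyIntegrable (μ := volume)) z
    rw [hkf] at h1
    refine h1.congr_fderiv ?_
    have hi1 : Integrable fun ζ => P (cutKernelDeriv ρ (d n) ζ) (G (z - ζ)) :=
      (P.continuous₂.comp ((hkfc n).prodMk (hG.comp (continuous_const.sub continuous_id)))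
        ).integrable_of_hasCompactSupport
        ((hkfs n).mono fun ζ hζ h => hζ (by
          change P (cutKernelDeriv ρ (d n) ζ) _ = 0
          rw [h, map_zero]; rfl))
    have hi2 : Integrable fun ζ => P (cutKernelDeriv ρ (d n) ζ) (G z) :=
      (P.continuous₂.comp ((hkfc n).prodMk continuous_const)
        ).integrable_of_hasCompactSupport
        ((hkfs n).mono fun ζ hζ h => hζ (by
          change P (cutKernelDeriv ρ (d n) ζ) _ = 0
          rw [h, map_zero]; rfl))
    simp only [map_sub]
    rw [integral_sub hi1 hi2, hzero, sub_zero]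
    rfl
  -- uniform convergence of the derivatives
  set N : ℂ → ℂ →L[ℝ] ℂ := cutKernelDeriv ρ 0 with hN
  have hNlim : ∀ᵐ ζ, Tendsto (fun n => cutKernelDeriv ρ (d n) ζ) atTop (𝓝 (N ζ)) := by
    filter_upwards [hne] with ζ hζ using tendsto_cutKernelDeriv ρ hζ hd
  have hNm : AEStronglyMeasurable N :=
    aestronglyMeasurable_of_tendsto_ae atTop (fun n => (hkfc n).aestronglyMeasurable) hNlim
  have hbi : Integrable ((Metric.ball 0 r).indicator (fun ζ => B * weight ζ)) :=
    IntegrableOn.integrable_indicator ((integrableOn_weight r).const_mul B) measurableSet_ball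
  set e : ℕ → ℝ := fun n => ∫ ζ, ‖cutKernelDeriv ρ (d n) ζ - N ζ‖ * √‖ζ‖ with he
  have hdom : ∀ n, ∀ᵐ ζ, ‖‖cutKernelDeriv ρ (d n) ζ - N ζ‖ * √‖ζ‖‖
      ≤ 2 * (Metric.ball 0 r).indicator (fun ζ => B * weight ζ) ζ := fun n => by
    filter_upwards [hne] with ζ hζ
    rw [Real.norm_of_nonneg (by positivity)]
    calc _ ≤ (‖cutKernelDeriv ρ (d n) ζ‖ + ‖N ζ‖) * √‖ζ‖ := by gcongr; exact norm_sub_le _ _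
      _ = ‖cutKernelDeriv ρ (d n) ζ‖ * √‖ζ‖ + ‖N ζ‖ * √‖ζ‖ := by ring
      _ ≤ _ := by
        have h1 := hB (d n) (hdpos n).le ζ hζ
        have h2 := hB 0 le_rfl ζ hζ
        linarith
  have hem : ∀ n, AEStronglyMeasurable fun ζ => ‖cutKernelDeriv ρ (d n) ζ - N ζ‖ * √‖ζ‖ := fun n =>
    (((hkfc n).aestronglyMeasurable.sub hNm).norm).mul
      (Real.continuous_sqrt.comp continuous_norm).aestronglyMeasurable
  have hei : ∀ n, Integrable fun ζ => ‖cutKernelDeriv ρ (d n) ζ - N ζ‖ * √‖ζ‖ := fun n =>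
    Integrable.mono' (hbi.const_mul 2) (hem n) (hdom n)
  have helim : Tendsto e atTop (𝓝 0) := by
    have := tendsto_integral_of_dominated_convergence _ hem (hbi.const_mul 2) hdom
      (f := fun _ => (0 : ℝ)) (by
        filter_upwards [hNlim] with ζ hζ
        have := ((hζ.sub_const (N ζ)).norm).mul_const (√‖ζ‖)
        simpa using this)
    simpa using this
  have hC0 : 0 ≤ C := by
    have := hh 0 1
    have h1 : (0 : ℝ) ≤ C * √‖(0 : ℂ) - 1‖ := (norm_nonneg _).trans this
    simpa using h1
  have hGs : ∀ z ζ, ‖G (z - ζ) - G z‖ ≤ C * √‖ζ‖ := fun z ζ => by simpa using hh (z - ζ) z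
  have hGzc : ∀ z, Continuous fun ζ => G (z - ζ) - G z := fun z =>
    (hG.comp (continuous_const.sub continuous_id)).sub continuous_const
  have hPi : ∀ (Q : ℂ → ℂ →L[ℝ] ℂ), AEStronglyMeasurable Q →
      (∀ᵐ ζ, ‖Q ζ‖ * √‖ζ‖ ≤ (Metric.ball 0 r).indicator (fun ζ => B * weight ζ) ζ) →
      ∀ z, Integrable fun ζ => P (Q ζ) (G (z - ζ) - G z) := fun Q hQ hQb z => by
    refine Integrable.mono' (hbi.const_mul (C))
      (P.aestronglyMeasurable_comp₂ hQ (hGzc z).aestronglyMeasurable) ?_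
    filter_upwards [hQb] with ζ hζ
    calc _ ≤ ‖Q ζ‖ * ‖G (z - ζ) - G z‖ := hPb _ _
      _ ≤ ‖Q ζ‖ * (C * √‖ζ‖) := by gcongr; exact hGs z ζ
      _ = C * (‖Q ζ‖ * √‖ζ‖) := by ring
      _ ≤ _ := by gcongr
  have hPn : ∀ n z, Integrable fun ζ => P (cutKernelDeriv ρ (d n) ζ) (G (z - ζ) - G z) := fun n =>
    hPi _ (hkfc n).aestronglyMeasurable (by
      filter_upwards [hne] with ζ hζ using hB _ (hdpos n).le ζ hζ)
  have hPN : ∀ z, Integrable fun ζ => P (N ζ) (G (z - ζ) - G z) :=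
    hPi _ hNm (by filter_upwards [hne] with ζ hζ using hB _ le_rfl ζ hζ)
  have hunif : TendstoUniformly
      (fun n z => ∫ ζ, P (cutKernelDeriv ρ (d n) ζ) (G (z - ζ) - G z))
      (fun z => ∫ ζ, P (N ζ) (G (z - ζ) - G z)) atTop := by
    rw [Metric.tendstoUniformly_iff]
    intro ε hε
    -- The bound `C * e n` on the difference of the derivatives does not involve `z`; this is what
    -- makes the convergence uniform.
    have h1 : Tendsto (fun n => C * e n) atTop (𝓝 0) := by simpa using helim.const_mul (C)
    filter_upwards [h1.eventually_lt_const hε] with n hn z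
    rw [dist_comm, dist_eq_norm, ← integral_sub (hPn n z) (hPN z)]
    refine lt_of_le_of_lt ?_ hn
    rw [he, ← integral_const_mul]
    refine norm_integral_le_of_norm_le ((hei n).const_mul _) (ae_of_all _ fun ζ => ?_)
    have : P (cutKernelDeriv ρ (d n) ζ) (G (z - ζ) - G z) - P (N ζ) (G (z - ζ) - G z)
        = P (cutKernelDeriv ρ (d n) ζ - N ζ) (G (z - ζ) - G z) := by
      rw [map_sub P, sub_apply]
    rw [this]
    calc _ ≤ ‖cutKernelDeriv ρ (d n) ζ - N ζ‖ * ‖G (z - ζ) - G z‖ := hPb _ _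
      _ ≤ ‖cutKernelDeriv ρ (d n) ζ - N ζ‖ * (C * √‖ζ‖) := by gcongr; exact hGs z ζ
      _ = _ := by ring
  -- pointwise convergence of the regularized convolutions
  have hptw : ∀ z, Tendsto (fun n => (k n ⋆[L, volume] G) z) atTop
      (𝓝 (((fun ζ => ρ ζ • cauchyReg 0 ζ) ⋆[L, volume] G) z)) := fun z => by
    have hi : Integrable ((Metric.ball 0 r).indicator fun ζ : ℂ => ‖ζ‖⁻¹) :=
      (integrableOn_inv_norm r).integrable_indicator measurableSet_ball
    refine tendsto_integral_of_dominated_convergence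
      (fun ζ => R * M * (Metric.ball 0 r).indicator (fun ζ : ℂ => ‖ζ‖⁻¹) ζ) (fun n => ?_)
      (hi.const_mul _) (fun n => ae_of_all _ fun ζ => ?_) (ae_of_all _ fun ζ => ?_)
    · exact (L.continuous₂.comp ((hk1 n).continuous.prodMk
        (hG.comp (continuous_const.sub continuous_id)))).aestronglyMeasurable
    · have h0 : ‖L (k n ζ) (G (z - ζ))‖ = ‖ρ ζ‖ * ‖cauchyReg (d n) ζ‖ * ‖G (z - ζ)‖ := by
        simp [hL, hk, norm_smul]
      rw [h0]
      by_cases hm : ζ ∈ Metric.ball (0 : ℂ) r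
      · rw [Set.indicator_of_mem hm]
        calc _ ≤ R * ‖ζ‖⁻¹ * M := by
              gcongr
              · exact hR ζ
              · exact norm_cauchyReg_le (hdpos n).le ζ
              · exact hM _
          _ = _ := by ring
      · rw [Set.indicator_of_notMem hm, image_eq_zero_of_notMem_tsupport fun h => hm (hr h)]
        simp
    · exact ((L.flip (G (z - ζ))).continuous.tendsto _).comp
        ((tendsto_cauchyReg ζ hd).const_smul (ρ ζ))
  have hlim := hasFDerivAt_of_tendstoUniformly hunif hderiv hptw
  rw [contDiff_one_iff_fderiv]
  refine ⟨fun z => (hlim z).differentiableAt, ?_⟩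
  rw [show fderiv ℝ ((fun ζ => ρ ζ • cauchyReg 0 ζ) ⋆[L, volume] G)
    = fun z => ∫ ζ, P (N ζ) (G (z - ζ) - G z) from funext fun z => (hlim z).fderiv]
  refine hunif.continuous (Frequently.of_forall fun n => ?_)
  have h1 : ContDiff ℝ 1 (k n ⋆[L, volume] G) :=
    (hkc n).contDiff_convolution_left L (n := 1) (hk1 n) hG.locallyIntegrable
  have h2 := h1.continuous_fderiv one_ne_zero
  rwa [show fderiv ℝ (k n ⋆[L, volume] G)
    = fun z => ∫ ζ, P (cutKernelDeriv ρ (d n) ζ) (G (z - ζ) - G z)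
    from funext fun z => (hderiv n z).fderiv] at h2

/-- The Cauchy transform of a Hölder continuous function with compact support is `C¹`. -/
theorem contDiff_cauchyConv {G : ℂ → F} (hG : Continuous G) (hGc : HasCompactSupport G) {C : ℝ}
    (hh : ∀ x y, ‖G x - G y‖ ≤ C * √‖x - y‖) : ContDiff ℝ 1 (cauchyConv G) := by
  rw [contDiff_iff_contDiffAt]
  intro z
  obtain ⟨R, hR⟩ : ∃ R, tsupport G ⊆ Metric.ball 0 R := hGc.isBounded.subset_ball 0
  -- The inner radius is chosen so that, for `y` within distance `1` of `z`, the cut-off equals `1`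
  -- at each `ζ` with `y - ζ` in the support of `G`. Near `z` the cut-off kernel and the full kernel
  -- therefore give the same convolution.
  let ρ : ContDiffBump (0 : ℂ) :=
    { rIn := |R| + ‖z‖ + 1, rOut := |R| + ‖z‖ + 2, rIn_pos := by positivity, rIn_lt_rOut := by linarith }
  refine (contDiff_convolution_cutKernel (ρ := ρ) ρ.contDiff ρ.hasCompactSupport hG hGc
    hh).contDiffAt.congr_of_eventuallyEq ?_
  filter_upwards [Metric.ball_mem_nhds z one_pos] with y hy
  rw [cauchyConv_apply]
  refine integral_congr_ae (ae_of_all _ fun ζ => ?_)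
  simp only [ContinuousLinearMap.lsmul_apply]
  by_cases h : y - ζ ∈ tsupport G
  · have h1 : ‖y - ζ‖ < R := mem_ball_zero_iff.1 (hR h)
    have h2 : ‖y - z‖ < 1 := mem_ball_iff_norm.1 hy
    have h3 : ζ ∈ Metric.closedBall (0 : ℂ) ρ.rIn := by
      rw [mem_closedBall_zero_iff]
      calc ‖ζ‖ = ‖(y - z) + z - (y - ζ)‖ := by congr 1; ring
        _ ≤ ‖y - z‖ + ‖z‖ + ‖y - ζ‖ := (norm_sub_le _ _).trans (by gcongr; exact norm_add_le _ _)
        _ ≤ |R| + ‖z‖ + 1 := by have := le_abs_self R; linarith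
    rw [ρ.one_of_mem_closedBall h3, one_smul]
  · rw [image_eq_zero_of_notMem_tsupport h, smul_zero, smul_zero]

end

/-! ### The operator `∂/∂z̄` and the Cauchy-Pompeiu formula -/

section

variable {F : Type*} [NormedAddCommGroup F] [NormedSpace ℝ F] [NormedSpace ℂ F]

/-- The operator `∂/∂z̄` applied to a real derivative. -/
def dbarOf (A : ℂ →L[ℝ] F) : F := (1 / 2 : ℂ) • (A 1 + Complex.I • A Complex.I)

/-- The derivative `∂u/∂z̄`. -/
def dbar (u : ℂ → F) (z : ℂ) : F := dbarOf (fderiv ℝ u z)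

theorem continuous_dbarOf : Continuous (dbarOf : (ℂ →L[ℝ] F) → F) := by
  unfold dbarOf
  fun_prop

variable [IsScalarTower ℝ ℂ F]

/-- The constant `∫ (1 + ‖ζ‖²)⁻² = π` in the Cauchy-Pompeiu formula. -/
def pompeiuConst : ℝ := ∫ ζ : ℂ, ((1 + ‖ζ‖ ^ 2) ^ 2)⁻¹

theorem integrable_pompeiu : Integrable fun ζ : ℂ => ((1 + ‖ζ‖ ^ 2) ^ 2)⁻¹ := by
  have h := integrable_rpow_neg_one_add_norm_sq (E := ℂ) (μ := volume) (r := 4)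
    (by rw [Complex.finrank_real_complex]; norm_num)
  refine h.congr (ae_of_all _ fun ζ => ?_)
  have h0 : (0 : ℝ) ≤ 1 + ‖ζ‖ ^ 2 := by positivity
  simp only
  rw [show (-4 / 2 : ℝ) = -((2 : ℕ) : ℝ) by norm_num, Real.rpow_neg h0, Real.rpow_natCast]

/-- The numerical value of the constant plays no role: the formula only has to be solved for `u`. -/
theorem pompeiuConst_pos : 0 < pompeiuConst := by
  refine (integral_pos_iff_support_of_nonneg (fun ζ => by positivity) integrable_pompeiu).2 ?_
  have : Function.support (fun ζ : ℂ => ((1 + ‖ζ‖ ^ 2) ^ 2)⁻¹) = Set.univ := by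
    ext ζ
    simp only [Function.mem_support, Set.mem_univ, iff_true]
    positivity
  rw [this]
  simp

/-- Integration by parts in both real directions moves `∂̄` onto the kernel. The reflected argument
`z - ζ` changes the sign of the derivatives of `u`, which cancels the sign from the integration by
parts. -/
theorem integral_cauchyReg_smul_dbar {u : ℂ → F} (hu : ContDiff ℝ 1 u) (hc : HasCompactSupport u)
    {δ : ℝ} (hδ : 0 < δ) (z : ℂ) :
    ∫ ζ, cauchyReg δ ζ • dbar u (z - ζ)
      = ∫ ζ, ((δ / (‖ζ‖ ^ 2 + δ) ^ 2 : ℝ) : ℂ) • u (z - ζ) := by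
  set v : ℂ → F := fun ζ => u (z - ζ) with hv
  have hv1 : ContDiff ℝ 1 v := hu.comp (contDiff_const.sub contDiff_id)
  have hvc : HasCompactSupport v := hc.comp_homeomorph (Homeomorph.subLeft z)
  have hvd : ∀ ζ e, fderiv ℝ v ζ e = -fderiv ℝ u (z - ζ) e := fun ζ e => by
    have h1 : HasFDerivAt (fun ζ : ℂ => z - ζ) (-ContinuousLinearMap.id ℝ ℂ) ζ := by
      simpa using (hasFDerivAt_id (𝕜 := ℝ) ζ).const_sub z
    have h2 := ((hu.differentiable one_ne_zero (z - ζ)).hasFDerivAt).comp ζ h1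
    have h3 : fderiv ℝ v ζ = _ := h2.fderiv
    rw [h3]; simp
  have hK := contDiff_cauchyReg hδ
  have hKd : ∀ ζ, fderiv ℝ (cauchyReg δ) ζ = cauchyRegDeriv δ ζ := fun ζ =>
    (hasFDerivAt_cauchyReg (by positivity)).fderiv
  have hKfc := hK.continuous_fderiv one_ne_zero
  have hvfc := hv1.continuous_fderiv one_ne_zero
  have hi1 : ∀ e, Integrable fun ζ => fderiv ℝ (cauchyReg δ) ζ e • v ζ := fun e =>
    ((hKfc.clm_apply continuous_const).smul hv1.continuous).integrable_of_hasCompactSupport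
      hvc.smul_left
  have hi2 : ∀ e, Integrable fun ζ => cauchyReg δ ζ • fderiv ℝ v ζ e := fun e =>
    (hK.continuous.smul (hvfc.clm_apply continuous_const)).integrable_of_hasCompactSupport
      ((hvc.fderiv_apply ℝ e).smul_left)
  have hi1' : Integrable fun ζ => Complex.I • fderiv ℝ (cauchyReg δ) ζ Complex.I • v ζ :=
    (hi1 Complex.I).smul Complex.I
  have hi2' : Integrable fun ζ => Complex.I • cauchyReg δ ζ • fderiv ℝ v ζ Complex.I :=
    (hi2 Complex.I).smul Complex.I
  have hi3 : Integrable fun ζ => cauchyReg δ ζ • v ζ :=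
    (hK.continuous.smul hv1.continuous).integrable_of_hasCompactSupport hvc.smul_left
  have ibp : ∀ e, ∫ ζ, cauchyReg δ ζ • fderiv ℝ v ζ e = -∫ ζ, fderiv ℝ (cauchyReg δ) ζ e • v ζ :=
    fun e => integral_smul_fderiv_eq_neg_fderiv_smul_of_integrable (hi1 e) (hi2 e) hi3
      (fun x _ => hK.differentiable one_ne_zero x) (fun x _ => hv1.differentiable one_ne_zero x)
  calc ∫ ζ, cauchyReg δ ζ • dbar u (z - ζ)
      = ∫ ζ, -((1 / 2 : ℂ) • (cauchyReg δ ζ • fderiv ℝ v ζ 1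
          + Complex.I • cauchyReg δ ζ • fderiv ℝ v ζ Complex.I)) := by
        refine integral_congr_ae (ae_of_all _ fun ζ => ?_)
        simp only [dbar, dbarOf, hvd]
        module
    _ = (1 / 2 : ℂ) • ((∫ ζ, fderiv ℝ (cauchyReg δ) ζ 1 • v ζ)
          + Complex.I • ∫ ζ, fderiv ℝ (cauchyReg δ) ζ Complex.I • v ζ) := by
        rw [integral_neg, integral_smul, integral_add (hi2 1) hi2',
          integral_smul, ibp, ibp]
        module
    _ = ∫ ζ, (1 / 2 : ℂ) • (fderiv ℝ (cauchyReg δ) ζ 1 • v ζ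
          + Complex.I • fderiv ℝ (cauchyReg δ) ζ Complex.I • v ζ) := by
        rw [integral_smul, integral_add (hi1 1) hi1', integral_smul]
    _ = _ := by
        refine integral_congr_ae (ae_of_all _ fun ζ => ?_)
        simp only [hKd]
        rw [← dbar_cauchyReg (by positivity)]
        module

/-- Substitution `ζ ↦ t ζ`, with Jacobian `t²`. The kernel becomes independent of `t`, so `t → 0` is
a dominated limit. -/
theorem integral_poisson_smul {u : ℂ → F} {t : ℝ} (ht : 0 < t) (z : ℂ) :
    ∫ ζ, ((t ^ 2 / (‖ζ‖ ^ 2 + t ^ 2) ^ 2 : ℝ) : ℂ) • u (z - ζ)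
      = ∫ ζ, (((1 + ‖ζ‖ ^ 2) ^ 2)⁻¹ : ℝ) • u (z - t • ζ) := by
  have h := Measure.integral_comp_smul (volume : Measure ℂ)
    (fun ζ => ((t ^ 2 / (‖ζ‖ ^ 2 + t ^ 2) ^ 2 : ℝ) : ℂ) • u (z - ζ)) t
  rw [Complex.finrank_real_complex, abs_of_pos (by positivity)] at h
  have h2 : ∀ x : F, x = (t ^ 2) • ((t ^ 2)⁻¹ • x) := fun x => by
    rw [smul_smul, mul_inv_cancel₀ (by positivity), one_smul]
  rw [h2 (∫ ζ, ((t ^ 2 / (‖ζ‖ ^ 2 + t ^ 2) ^ 2 : ℝ) : ℂ) • u (z - ζ)), ← h, ← integral_smul]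
  refine integral_congr_ae (ae_of_all _ fun ζ => ?_)
  simp only
  rw [← RCLike.ofReal_eq_complex_ofReal, ← RCLike.real_smul_eq_coe_smul (K := ℂ), smul_smul]
  congr 1
  rw [norm_smul, Real.norm_of_nonneg ht.le]
  have : 0 < 1 + ‖ζ‖ ^ 2 := by positivity
  have h3 : (t * ‖ζ‖) ^ 2 + t ^ 2 = t ^ 2 * (1 + ‖ζ‖ ^ 2) := by ring
  rw [h3]
  field_simp

/-- The Cauchy-Pompeiu formula. -/
theorem cauchyConv_dbar [CompleteSpace F] {u : ℂ → F} (hu : ContDiff ℝ 1 u)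
    (hc : HasCompactSupport u) : cauchyConv (dbar u) = pompeiuConst • u := by
  ext z
  set t : ℕ → ℝ := fun n => 1 / ((n : ℝ) + 1)
  have ht : Tendsto t atTop (𝓝 0) := tendsto_one_div_add_atTop_nhds_zero_nat
  have htpos : ∀ n, 0 < t n := fun n => by positivity
  have ht2 : Tendsto (fun n => t n ^ 2) atTop (𝓝 0) := by simpa using ht.pow 2
  have hdc : Continuous (dbar u) := continuous_dbarOf.comp (hu.continuous_fderiv one_ne_zero)
  have hds : HasCompactSupport (dbar u) := (hc.fderiv ℝ).comp_left (g := dbarOf) (by simp [dbarOf])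
  obtain ⟨M, hM0, hM⟩ := exists_norm_le_of_hasCompactSupport hdc hds
  obtain ⟨M', hM'0, hM'⟩ := exists_norm_le_of_hasCompactSupport hu.continuous hc
  have hsc : HasCompactSupport fun ζ => dbar u (z - ζ) :=
    hds.comp_homeomorph (Homeomorph.subLeft z)
  obtain ⟨r, hr⟩ : ∃ r, tsupport (fun ζ => dbar u (z - ζ)) ⊆ Metric.ball 0 r :=
    hsc.isBounded.subset_ball 0
  have h1 : Tendsto (fun n => ∫ ζ, cauchyReg (t n ^ 2) ζ • dbar u (z - ζ)) atTop
      (𝓝 (cauchyConv (dbar u) z)) := by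
    have hi : Integrable ((Metric.ball 0 r).indicator fun ζ : ℂ => ‖ζ‖⁻¹) :=
      (integrableOn_inv_norm r).integrable_indicator measurableSet_ball
    refine tendsto_integral_of_dominated_convergence
      (fun ζ => M * (Metric.ball 0 r).indicator (fun ζ : ℂ => ‖ζ‖⁻¹) ζ) (fun n => ?_)
      (hi.const_mul _) (fun n => ae_of_all _ fun ζ => ?_) (ae_of_all _ fun ζ => ?_)
    · exact ((contDiff_cauchyReg (by have := htpos n; positivity)).continuous.smul
        (hdc.comp (continuous_const.sub continuous_id))).aestronglyMeasurable
    · rw [norm_smul]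
      by_cases hm : ζ ∈ Metric.ball (0 : ℂ) r
      · rw [Set.indicator_of_mem hm, mul_comm]
        gcongr
        · exact hM _
        · exact norm_cauchyReg_le (by positivity) ζ
      · rw [Set.indicator_of_notMem hm,
          show dbar u (z - ζ) = 0 from image_eq_zero_of_notMem_tsupport
            (f := fun ζ => dbar u (z - ζ)) fun h => hm (hr h)]
        simp
    · exact (tendsto_cauchyReg ζ ht2).smul_const _
  have h2 : Tendsto (fun n => ∫ ζ, (((1 + ‖ζ‖ ^ 2) ^ 2)⁻¹ : ℝ) • u (z - t n • ζ)) atTop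
      (𝓝 (∫ ζ : ℂ, (((1 + ‖ζ‖ ^ 2) ^ 2)⁻¹ : ℝ) • u z)) := by
    refine tendsto_integral_of_dominated_convergence
      (fun ζ => ((1 + ‖ζ‖ ^ 2) ^ 2)⁻¹ * M') (fun n => ?_)
      (integrable_pompeiu.mul_const _) (fun n => ae_of_all _ fun ζ => ?_) (ae_of_all _ fun ζ => ?_)
    · exact integrable_pompeiu.aestronglyMeasurable.smul
        (hu.continuous.comp (by fun_prop)).aestronglyMeasurable
    · rw [norm_smul, Real.norm_of_nonneg (by positivity)]
      gcongr
      exact hM' _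
    · refine Tendsto.const_smul ?_ _
      refine (hu.continuous.tendsto z).comp ?_
      simpa using (ht.smul_const ζ).const_sub z
  have h3 : (fun n => ∫ ζ, cauchyReg (t n ^ 2) ζ • dbar u (z - ζ))
      = fun n => ∫ ζ, (((1 + ‖ζ‖ ^ 2) ^ 2)⁻¹ : ℝ) • u (z - t n • ζ) := funext fun n => by
    rw [integral_cauchyReg_smul_dbar hu hc (by have := htpos n; positivity),
      integral_poisson_smul (htpos n)]
  rw [h3] at h1
  rw [tendsto_nhds_unique h1 h2, integral_smul_const]
  rfl

end

/-! ### Bounded Hölder functions of exponent `1/2` -/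

section

variable {E E' E'' : Type*} [NormedAddCommGroup E] [NormedSpace ℝ E] [NormedAddCommGroup E']
  [NormedSpace ℝ E'] [NormedAddCommGroup E''] [NormedSpace ℝ E'']

/-- Bounded and Hölder continuous with exponent `1/2`. -/
def BddHolder {X : Type*} [NormedAddCommGroup X] (f : ℂ → X) : Prop :=
  ∃ C, 0 ≤ C ∧ (∀ x, ‖f x‖ ≤ C) ∧ ∀ x y, ‖f x - f y‖ ≤ C * √‖x - y‖

theorem bddHolder_of_contDiff {f : ℂ → E} (hf : ContDiff ℝ 1 f) (hc : HasCompactSupport f) :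
    BddHolder f := by
  obtain ⟨M, hM0, hM⟩ := exists_norm_le_of_hasCompactSupport hf.continuous hc
  obtain ⟨M', hM'0, hM'⟩ := exists_norm_le_of_hasCompactSupport
    (hf.continuous_fderiv one_ne_zero) (hc.fderiv ℝ)
  refine ⟨2 * M + M', by positivity, fun x => (hM x).trans (by linarith), fun x y => ?_⟩
  have h1 : ‖f x - f y‖ ≤ M' * ‖x - y‖ :=
    Convex.norm_image_sub_le_of_norm_fderiv_le (fun z _ => hf.differentiable one_ne_zero z)
      (fun z _ => hM' z) convex_univ trivial trivial
  have h2 : ‖f x - f y‖ ≤ 2 * M := (norm_sub_le _ _).trans (by linarith [hM x, hM y])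
  have hs := Real.mul_self_sqrt (norm_nonneg (x - y))
  have hs0 := Real.sqrt_nonneg ‖x - y‖
  rcases le_total 1 (√‖x - y‖) with h | h
  · nlinarith [mul_nonneg hM'0 hs0]
  · have : ‖x - y‖ ≤ √‖x - y‖ := by nlinarith
    nlinarith [mul_le_mul_of_nonneg_left this hM'0, mul_nonneg hM0 hs0]

theorem BddHolder.bilinear {f : ℂ → E} {g : ℂ → E'} (hf : BddHolder f) (hg : BddHolder g)
    (B : E →L[ℝ] E' →L[ℝ] E'') : BddHolder fun z => B (f z) (g z) := by
  obtain ⟨C, hC0, hC, hC'⟩ := hf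
  obtain ⟨D, hD0, hD, hD'⟩ := hg
  refine ⟨2 * (‖B‖ * C * D), by positivity, fun x => ?_, fun x y => ?_⟩
  · calc _ ≤ ‖B‖ * ‖f x‖ * ‖g x‖ := B.le_opNorm₂ _ _
      _ ≤ ‖B‖ * C * D := by gcongr <;> solve_by_elim
      _ ≤ _ := by nlinarith [mul_nonneg (mul_nonneg (norm_nonneg B) hC0) hD0]
  · have : B (f x) (g x) - B (f y) (g y) = B (f x - f y) (g x) + B (f y) (g x - g y) := by
      rw [map_sub B, sub_apply, map_sub]; abel
    rw [this]
    calc _ ≤ ‖B‖ * ‖f x - f y‖ * ‖g x‖ + ‖B‖ * ‖f y‖ * ‖g x - g y‖ :=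
          (norm_add_le _ _).trans (add_le_add (B.le_opNorm₂ _ _) (B.le_opNorm₂ _ _))
      _ ≤ ‖B‖ * (C * √‖x - y‖) * D + ‖B‖ * C * (D * √‖x - y‖) := by
        gcongr <;> solve_by_elim
      _ = _ := by ring

/-- If `Ψ` is `C²` and vanishes off a compact set of base points, and if `W` is `C¹` with compact
support and Hölder continuous derivative, then `z ↦ Ψ (z, W z)` has Hölder derivative. -/
theorem bddHolder_fderiv_comp {Ψ : ℂ × E → E'} (hΨ : ContDiff ℝ 2 Ψ) {K : Set ℂ} (hK : IsCompact K)
    (hΨK : ∀ z ∉ K, ∀ w, Ψ (z, w) = 0) {W : ℂ → E} (hW : ContDiff ℝ 1 W)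
    (hW' : BddHolder (fderiv ℝ W)) : BddHolder (fderiv ℝ fun z => Ψ (z, W z)) := by
  have h1 : ∀ z, fderiv ℝ (fun z => Ψ (z, W z)) z
      = (fderiv ℝ Ψ (z, W z)).comp ((ContinuousLinearMap.id ℝ ℂ).prod (fderiv ℝ W z)) := fun z =>
    (((hΨ.differentiable two_ne_zero (z, W z)).hasFDerivAt).comp z
      ((hasFDerivAt_id z).prodMk (hW.differentiable one_ne_zero z).hasFDerivAt)).fderiv
  rw [funext h1]
  have h2 : ContDiff ℝ 1 fun z => fderiv ℝ Ψ (z, W z) :=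
    (hΨ.fderiv_right (m := 1) (by norm_num)).comp (contDiff_id.prodMk hW)
  have h3 : HasCompactSupport fun z => fderiv ℝ Ψ (z, W z) := by
    refine HasCompactSupport.intro hK fun z hz => ?_
    have : Ψ =ᶠ[𝓝 (z, W z)] fun _ => 0 := by
      have : ∀ᶠ p : ℂ × E in 𝓝 (z, W z), p.1 ∈ Kᶜ :=
        continuous_fst.continuousAt.eventually (hK.isClosed.isOpen_compl.mem_nhds hz)
      filter_upwards [this] with p hp using hΨK p.1 hp p.2
    rw [this.fderiv_eq]; simp
  have h4 : BddHolder fun z => (ContinuousLinearMap.id ℝ ℂ).prod (fderiv ℝ W z) := by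
    obtain ⟨C, hC0, hC, hC'⟩ := hW'
    refine ⟨C + 1, by positivity, fun x => ?_, fun x y => ?_⟩
    · refine ContinuousLinearMap.opNorm_le_bound _ (by positivity) fun v => ?_
      refine norm_prod_le_iff.2 ⟨?_, ?_⟩
      · simp only [ContinuousLinearMap.prod_apply, ContinuousLinearMap.id_apply]
        nlinarith [norm_nonneg v]
      · refine ((fderiv ℝ W x).le_of_opNorm_le (hC x) v).trans ?_
        nlinarith [norm_nonneg v]
    · have hs := Real.sqrt_nonneg ‖x - y‖
      refine ContinuousLinearMap.opNorm_le_bound _ (by positivity) fun v => ?_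
      refine norm_prod_le_iff.2 ⟨?_, ?_⟩
      · simp
        positivity
      · refine ((fderiv ℝ W x - fderiv ℝ W y).le_of_opNorm_le (hC' x y) v).trans ?_
        gcongr
        linarith
  exact (bddHolder_of_contDiff h2 h3).bilinear h4 (ContinuousLinearMap.compL ℝ ℂ (ℂ × E) E')

end

/-! ### Regularity of solutions of `∂W/∂z̄ = P(W)` -/

section

variable {F : Type*} [NormedAddCommGroup F] [NormedSpace ℝ F] [NormedSpace ℂ F]
  [IsScalarTower ℝ ℂ F]

theorem dbar_smul {χ : ℂ → ℝ} {W : ℂ → F} {z : ℂ} (hχ : DifferentiableAt ℝ χ z)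
    (hW : DifferentiableAt ℝ W z) :
    dbar (fun z => χ z • W z) z = χ z • dbar W z + dbarOf ((fderiv ℝ χ z).smulRight (W z)) := by
  have h : fderiv ℝ (fun z => χ z • W z) z = _ := (hχ.hasFDerivAt.smul hW.hasFDerivAt).fderiv
  rw [dbar, dbar, h]
  simp only [dbarOf, add_apply, ContinuousLinearMap.smulRight_apply, smul_apply, smul_add]
  simp only [smul_comm (χ z) (_ : ℂ) (_ : F)]
  abel

theorem contDiff_dbarOf_smulRight {χ : ℂ → ℝ} {n : ℕ∞} (hχ : ContDiff ℝ ∞ χ) :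
    ContDiff ℝ n fun p : ℂ × F => dbarOf ((fderiv ℝ χ p.1).smulRight p.2) := by
  have h : ∀ v : ℂ, ContDiff ℝ n fun p : ℂ × F => fderiv ℝ χ p.1 v := fun v =>
    ((hχ.fderiv_right (m := n) (by exact_mod_cast le_top)).comp contDiff_fst).clm_apply
      contDiff_const
  simp only [dbarOf, ContinuousLinearMap.smulRight_apply]
  exact (((h 1).smul contDiff_snd).add (((h Complex.I).smul contDiff_snd).const_smul _)).const_smul _

theorem contDiff_of_contDiffOn_of_tsupport {E : Type*} [NormedAddCommGroup E] [NormedSpace ℝ E]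
    {f : ℂ → E} {U : Set ℂ} {n : WithTop ℕ∞} (hU : IsOpen U) (hf : ContDiffOn ℝ n f U)
    (hs : ∀ z ∉ U, ∀ᶠ y in 𝓝 z, f y = 0) : ContDiff ℝ n f := by
  rw [contDiff_iff_contDiffAt]
  intro z
  by_cases hz : z ∈ U
  · exact hf.contDiffAt (hU.mem_nhds hz)
  · exact (contDiffAt_const (c := (0 : E))).congr_of_eventuallyEq (hs z hz)

/-- The Cauchy-Pompeiu formula writes `W` as a convolution, and the derivative may fall on the
second factor. All derivatives of `W` are thus controlled by those of `∂̄W`. -/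
theorem fderiv_eq_of_dbar [CompleteSpace F] {W : ℂ → F} (hW : ContDiff ℝ 1 W)
    (hc : HasCompactSupport W) (hd : ContDiff ℝ 1 (dbar W)) :
    fderiv ℝ W = pompeiuConst⁻¹ • cauchyConv (fderiv ℝ (dbar W)) := by
  have hds : HasCompactSupport (dbar W) := (hc.fderiv ℝ).comp_left (g := dbarOf) (by simp [dbarOf])
  have h1 : W = pompeiuConst⁻¹ • cauchyConv (dbar W) := by
    rw [cauchyConv_dbar hW hc, smul_smul, inv_mul_cancel₀ pompeiuConst_pos.ne', one_smul]
  ext1 z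
  conv_lhs => rw [h1]
  exact ((hasFDerivAt_cauchyConv hd hds z).const_smul pompeiuConst⁻¹).fderiv

theorem bddHolder_fderiv_of_dbar [CompleteSpace F] {W : ℂ → F} (hW : ContDiff ℝ 1 W)
    (hc : HasCompactSupport W) (hd : ContDiff ℝ 1 (dbar W)) : BddHolder (fderiv ℝ W) := by
  have hds : HasCompactSupport (dbar W) := (hc.fderiv ℝ).comp_left (g := dbarOf) (by simp [dbarOf])
  obtain ⟨C, hC0, hC⟩ := exists_holder_cauchyConv (hd.continuous_fderiv one_ne_zero) (hds.fderiv ℝ)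
  obtain ⟨M, hM0, hM⟩ := exists_norm_le_of_hasCompactSupport
    (hW.continuous_fderiv one_ne_zero) (hc.fderiv ℝ)
  have hp := pompeiuConst_pos
  refine ⟨M + pompeiuConst⁻¹ * C, by positivity, fun x => (hM x).trans ?_, fun x y => ?_⟩
  · have : 0 ≤ pompeiuConst⁻¹ * C := by positivity
    linarith
  · rw [fderiv_eq_of_dbar hW hc hd, Pi.smul_apply, Pi.smul_apply, ← smul_sub, norm_smul,
      Real.norm_of_nonneg (by positivity)]
    have hs := Real.sqrt_nonneg ‖x - y‖
    calc _ ≤ pompeiuConst⁻¹ * (C * √‖x - y‖) := by gcongr; exact hC x y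
      _ ≤ _ := by nlinarith

theorem contDiff_two_of_dbar [CompleteSpace F] {W : ℂ → F} (hW : ContDiff ℝ 1 W)
    (hc : HasCompactSupport W) (hd : ContDiff ℝ 1 (dbar W))
    (hh : BddHolder (fderiv ℝ (dbar W))) : ContDiff ℝ 2 W := by
  have hds : HasCompactSupport (dbar W) := (hc.fderiv ℝ).comp_left (g := dbarOf) (by simp [dbarOf])
  obtain ⟨C, -, -, hC⟩ := hh
  rw [show (2 : WithTop ℕ∞) = 1 + 1 by norm_num, contDiff_succ_iff_fderiv]
  refine ⟨hW.differentiable one_ne_zero, by simp, ?_⟩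
  rw [fderiv_eq_of_dbar hW hc hd]
  exact contDiff_const.smul
    (contDiff_cauchyConv (hd.continuous_fderiv one_ne_zero) (hds.fderiv ℝ) hC)

/-- A `C¹` solution of `∂W/∂z̄ = P(W)` is `C²`. -/
theorem contDiffAt_two_of_dbar_eq [CompleteSpace F] {U : Set ℂ} (hU : IsOpen U) {P : F → F}
    (hP : ContDiff ℝ ∞ P) {W : ℂ → F} (hW : ContDiffOn ℝ 1 W U) (hd : ∀ z ∈ U, dbar W z = P (W z))
    {z₀ : ℂ} (hz₀ : z₀ ∈ U) : ContDiffAt ℝ 2 W z₀ := by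
  obtain ⟨r, hr, hrU⟩ : ∃ r > 0, Metric.closedBall z₀ (2 * r) ⊆ U := by
    obtain ⟨ε, hε, h⟩ := Metric.nhds_basis_closedBall.mem_iff.1 (hU.mem_nhds hz₀)
    exact ⟨ε / 2, by positivity, by simpa [mul_div_cancel₀] using h⟩
  let χ₁ : ContDiffBump z₀ := { rIn := r, rOut := 2 * r, rIn_pos := hr, rIn_lt_rOut := by linarith }
  let χ₂ : ContDiffBump z₀ :=
    { rIn := r / 4, rOut := r / 2, rIn_pos := by positivity, rIn_lt_rOut := by linarith }
  have hχ₁ : ContDiff ℝ ∞ χ₁ := χ₁.contDiff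
  have hχ₂ : ContDiff ℝ ∞ χ₂ := χ₂.contDiff
  have hχ₁U : ∀ z ∉ U, ∀ᶠ y in 𝓝 z, χ₁ y = 0 := fun z hz => by
    have : z ∈ (tsupport χ₁)ᶜ := fun h => hz (hrU (by rwa [χ₁.tsupport_eq] at h))
    filter_upwards [(isClosed_tsupport χ₁).isOpen_compl.mem_nhds this] with y hy
    exact image_eq_zero_of_notMem_tsupport hy
  have hdiffW : ∀ z ∈ U, DifferentiableAt ℝ W z := fun z hz =>
    (hW.differentiableOn one_ne_zero).differentiableAt (hU.mem_nhds hz)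
  -- first cut-off
  set W₁ : ℂ → F := fun z => χ₁ z • W z with hW₁
  have hW₁C : ContDiff ℝ 1 W₁ := contDiff_of_contDiffOn_of_tsupport hU
    ((hχ₁.of_le (by norm_num)).contDiffOn.smul hW) fun z hz => by
      filter_upwards [hχ₁U z hz] with y hy
      simp [hW₁, hy]
  have hW₁s : HasCompactSupport W₁ := χ₁.hasCompactSupport.smul_right
  have hd₁ : ContDiff ℝ 1 (dbar W₁) := by
    refine contDiff_of_contDiffOn_of_tsupport hU ?_ fun z hz => ?_
    · have : ContDiffOn ℝ 1 (fun z => χ₁ z • P (W z) + dbarOf ((fderiv ℝ χ₁ z).smulRight (W z))) U := by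
        refine ((hχ₁.of_le (by norm_num)).contDiffOn.smul
          ((hP.of_le (by norm_num)).comp_contDiffOn hW)).add ?_
        exact (contDiff_dbarOf_smulRight (n := 1) hχ₁).comp_contDiffOn (contDiffOn_id.prodMk hW)
      refine this.congr fun z hz => ?_
      rw [hW₁, dbar_smul (hχ₁.differentiable (by norm_num) z) (hdiffW z hz), hd z hz]
    · filter_upwards [(hχ₁U z hz).eventually_nhds] with y hy
      have : W₁ =ᶠ[𝓝 y] fun _ => 0 := by
        filter_upwards [hy] with x hx
        simp [hW₁, hx]
      rw [dbar, this.fderiv_eq]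
      simp [dbarOf]
  -- The gain from `C¹` to Hölder derivative holds for `W₁`. On the transition region of `χ₁` the
  -- function `∂̄W₁` still involves `W` itself, so the next gain uses a cut-off supported where `χ₁
  -- = 1` and `W₁` solves the equation.
  have hH₁ := bddHolder_fderiv_of_dbar hW₁C hW₁s hd₁
  have hW₁W : ∀ z ∈ Metric.ball z₀ r, W₁ z = W z := fun z hz => by
    rw [hW₁]; simp only
    rw [χ₁.one_of_mem_closedBall (Metric.ball_subset_closedBall hz), one_smul]
  have hd₁P : ∀ z ∈ Metric.ball z₀ r, dbar W₁ z = P (W₁ z) := fun z hz => by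
    have h1 : W₁ =ᶠ[𝓝 z] W := by
      filter_upwards [Metric.isOpen_ball.mem_nhds hz] with y hy using hW₁W y hy
    rw [hW₁W z hz, dbar, h1.fderiv_eq]
    exact hd z (hrU (Metric.ball_subset_closedBall (Metric.ball_subset_ball (by linarith) hz)))
  -- second cut-off
  set W₂ : ℂ → F := fun z => χ₂ z • W₁ z with hW₂
  have hW₂C : ContDiff ℝ 1 W₂ := (hχ₂.of_le (by norm_num)).smul hW₁C
  have hW₂s : HasCompactSupport W₂ := χ₂.hasCompactSupport.smul_right
  set Ψ : ℂ × F → F := fun p => χ₂ p.1 • P p.2 + dbarOf ((fderiv ℝ χ₂ p.1).smulRight p.2) with hΨ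
  have hΨC : ContDiff ℝ 2 Ψ := by
    refine ContDiff.add ?_ (contDiff_dbarOf_smulRight (n := 2) hχ₂)
    exact ((hχ₂.of_le (mod_cast le_top : ((2 : ℕ∞) : WithTop ℕ∞) ≤ ∞)).comp contDiff_fst).smul
      ((hP.of_le (mod_cast le_top : ((2 : ℕ∞) : WithTop ℕ∞) ≤ ∞)).comp contDiff_snd)
  have hd₂ : dbar W₂ = fun z => Ψ (z, W₁ z) := funext fun z => by
    rw [hW₂, dbar_smul (hχ₂.differentiable (by norm_num) z) (hW₁C.differentiable one_ne_zero z)]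
    by_cases hz : z ∈ Metric.ball z₀ r
    · rw [hd₁P z hz]
    · have : χ₂ z = 0 := χ₂.zero_of_le_dist (by
        have : r ≤ dist z z₀ := by simpa using hz
        change r / 2 ≤ _
        linarith)
      simp [hΨ, this]
  have hΨK : ∀ z ∉ tsupport χ₂, ∀ w, Ψ (z, w) = 0 := fun z hz w => by
    have h1 : χ₂ z = 0 := image_eq_zero_of_notMem_tsupport hz
    have h2 : fderiv ℝ χ₂ z = 0 := fderiv_of_notMem_tsupport ℝ hz
    simp [hΨ, h1, h2, dbarOf]
  have hd₂C : ContDiff ℝ 1 (dbar W₂) := by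
    rw [hd₂]
    exact (hΨC.of_le (by norm_num)).comp (contDiff_id.prodMk hW₁C)
  have hH₂ : BddHolder (fderiv ℝ (dbar W₂)) := by
    rw [hd₂]
    exact bddHolder_fderiv_comp hΨC χ₂.hasCompactSupport hΨK hW₁C hH₁
  refine (contDiff_two_of_dbar hW₂C hW₂s hd₂C hH₂).contDiffAt.congr_of_eventuallyEq ?_
  filter_upwards [Metric.ball_mem_nhds z₀ (show 0 < r / 4 by positivity)] with z hz
  rw [hW₂]; simp only
  rw [χ₂.one_of_mem_closedBall (Metric.ball_subset_closedBall hz), one_smul,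
    hW₁W z (Metric.ball_subset_ball (by linarith) hz)]

theorem contDiffOn_two_of_dbar_eq [CompleteSpace F] {U : Set ℂ} (hU : IsOpen U) {P : F → F}
    (hP : ContDiff ℝ ∞ P) {W : ℂ → F} (hW : ContDiffOn ℝ 1 W U) (hd : ∀ z ∈ U, dbar W z = P (W z)) :
    ContDiffOn ℝ 2 W U := fun _ hz =>
  (contDiffAt_two_of_dbar_eq hU hP hW hd hz).contDiffWithinAt

/-- Differentiate the equation; symmetry of the second derivative lets `∂̄` and the differential be
interchanged. -/
theorem dbarOf_fderiv_fderiv {U : Set ℂ} (hU : IsOpen U) {P : F → F}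
    (hP : ContDiff ℝ ∞ P) {W : ℂ → F} (hW : ContDiffOn ℝ 2 W U) (hd : ∀ z ∈ U, dbar W z = P (W z))
    {z : ℂ} (hz : z ∈ U) :
    dbarOf (fderiv ℝ (fderiv ℝ W) z) = (fderiv ℝ P (W z)).comp (fderiv ℝ W z) := by
  have hWz : ContDiffAt ℝ 2 W z := hW.contDiffAt (hU.mem_nhds hz)
  have hW' : DifferentiableAt ℝ (fderiv ℝ W) z :=
    (hWz.fderiv_right (m := 1) (by norm_num)).differentiableAt one_ne_zero
  have hsymm : IsSymmSndFDerivAt ℝ W z := hWz.isSymmSndFDerivAt (by simp)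
  have h1 : dbar W =ᶠ[𝓝 z] fun z => P (W z) := by
    filter_upwards [hU.mem_nhds hz] with y hy using hd y hy
  have h2 : fderiv ℝ (fun z => P (W z)) z = (fderiv ℝ P (W z)).comp (fderiv ℝ W z) :=
    (((hP.differentiable (by norm_num) (W z)).hasFDerivAt).comp z
      (hWz.differentiableAt two_ne_zero).hasFDerivAt).fderiv
  have h3 : ∀ v : ℂ, HasFDerivAt (fun y => fderiv ℝ W y v) ((fderiv ℝ (fderiv ℝ W) z).flip v) z :=
    fun v => by
      have := hW'.hasFDerivAt.clm_apply (hasFDerivAt_const v z)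
      refine this.congr_fderiv ?_
      ext w
      simp
  have h4 : HasFDerivAt (dbar W) ((1 / 2 : ℂ) • ((fderiv ℝ (fderiv ℝ W) z).flip 1
      + Complex.I • (fderiv ℝ (fderiv ℝ W) z).flip Complex.I)) z :=
    ((h3 1).add ((h3 Complex.I).const_smul Complex.I)).const_smul (1 / 2 : ℂ)
  rw [← h2, ← h1.fderiv_eq, h4.fderiv]
  refine ContinuousLinearMap.ext fun v => ?_
  simp only [dbarOf, add_apply, smul_apply, ContinuousLinearMap.flip_apply, hsymm.eq v]

/-- Bootstrap: the pair `(W, DW)` solves a system of the same kind with right side `P'`, so each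
step of the induction gains one derivative. The target space changes at each step, hence the
quantification over `F` inside the induction. -/
theorem contDiffOn_nat_of_dbar_eq (n : ℕ) : ∀ {F : Type*} [NormedAddCommGroup F] [NormedSpace ℝ F]
    [NormedSpace ℂ F] [IsScalarTower ℝ ℂ F] [CompleteSpace F] {U : Set ℂ}, IsOpen U →
    ∀ {P : F → F}, ContDiff ℝ ∞ P → ∀ {W : ℂ → F}, ContDiffOn ℝ 1 W U →
    (∀ z ∈ U, dbar W z = P (W z)) → ContDiffOn ℝ n W U := by
  induction n with
  | zero => exact fun _ _ _ _ hW _ => hW.of_le (by norm_num)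
  | succ n ih =>
    intro F _ _ _ _ _ U hU P hP W hW hd
    have hW2 := contDiffOn_two_of_dbar_eq hU hP hW hd
    have hW' : ContDiffOn ℝ 1 (fderiv ℝ W) U := hW2.fderiv_of_isOpen hU (by norm_num)
    let P' : F × (ℂ →L[ℝ] F) → F × (ℂ →L[ℝ] F) := fun p => (P p.1, (fderiv ℝ P p.1).comp p.2)
    have hP' : ContDiff ℝ ∞ P' :=
      (hP.comp contDiff_fst).prodMk
        (((hP.fderiv_right (m := ∞) le_rfl).comp contDiff_fst).clm_comp contDiff_snd)
    have h := ih hU hP' (W := fun z => (W z, fderiv ℝ W z)) (hW.prodMk hW') fun z hz => by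
      have hWz := (hW.differentiableOn one_ne_zero).differentiableAt (hU.mem_nhds hz)
      have hWz' := (hW'.differentiableOn one_ne_zero).differentiableAt (hU.mem_nhds hz)
      rw [dbar, (hWz.hasFDerivAt.prodMk hWz'.hasFDerivAt).fderiv]
      refine Prod.ext (hd z hz) ?_
      exact dbarOf_fderiv_fderiv hU hP hW2 hd hz
    rw [show ((n + 1 : ℕ) : WithTop ℕ∞) = n + 1 by push_cast; rfl,
      contDiffOn_succ_iff_fderiv_of_isOpen hU]
    exact ⟨hW.differentiableOn one_ne_zero, by simp, h.snd⟩

/-- Regularity of `C¹` solutions of `∂W/∂z̄ = P(W)` with smooth `P`. -/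
theorem contDiffOn_infty_of_dbar_eq [CompleteSpace F] {U : Set ℂ} (hU : IsOpen U) {P : F → F}
    (hP : ContDiff ℝ ∞ P) {W : ℂ → F} (hW : ContDiffOn ℝ 1 W U) (hd : ∀ z ∈ U, dbar W z = P (W z)) :
    ContDiffOn ℝ ∞ W U :=
  contDiffOn_infty.2 fun n => contDiffOn_nat_of_dbar_eq n hU hP hW hd

end

/-! ### Reduction of second order systems to `∂W/∂z̄ = P(W)` -/

/-- The complexification of `L4`. -/
abbrev CL4 : Type := (Fin 3 → ℂ) × ℂ

/-- The inclusion of `L4` in its complexification. -/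
def ofRealL : L4 →L[ℝ] CL4 :=
  (ContinuousLinearMap.pi fun i => Complex.ofRealCLM.comp
      ((ContinuousLinearMap.proj i).comp (ContinuousLinearMap.fst ℝ L3 ℝ))).prod
    (Complex.ofRealCLM.comp (ContinuousLinearMap.snd ℝ L3 ℝ))

/-- The real part `CL4 → L4`. -/
def reL : CL4 →L[ℝ] L4 :=
  (ContinuousLinearMap.pi fun i => Complex.reCLM.comp
      ((ContinuousLinearMap.proj i).comp (ContinuousLinearMap.fst ℝ (Fin 3 → ℂ) ℂ))).prod
    (Complex.reCLM.comp (ContinuousLinearMap.snd ℝ (Fin 3 → ℂ) ℂ))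

/-- The imaginary part `CL4 → L4`. -/
def imL : CL4 →L[ℝ] L4 :=
  (ContinuousLinearMap.pi fun i => Complex.imCLM.comp
      ((ContinuousLinearMap.proj i).comp (ContinuousLinearMap.fst ℝ (Fin 3 → ℂ) ℂ))).prod
    (Complex.imCLM.comp (ContinuousLinearMap.snd ℝ (Fin 3 → ℂ) ℂ))

theorem reL_ofRealL_sub (x y : L4) : reL (ofRealL x - Complex.I • ofRealL y) = x := by
  ext <;> simp [reL, ofRealL]

theorem imL_ofRealL_sub (x y : L4) : imL (ofRealL x - Complex.I • ofRealL y) = -y := by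
  ext <;> simp [imL, ofRealL]

theorem reL_ofRealL (x : L4) : reL (ofRealL x) = x := by
  ext <;> simp [reL, ofRealL]

/-- Interior regularity for semilinear elliptic systems `ψ_ss + ψ_tt = Q (ψ, ψ_s, ψ_t)`. -/
theorem contDiffOn_infty_of_laplacian_eq {U : Set ℂ} (hU : IsOpen U) {Q : L4 × L4 × L4 → L4}
    (hQ : ContDiff ℝ ∞ Q) {ψ : ℂ → L4} (hψ : ContDiffOn ℝ 2 ψ U)
    (hΔ : ∀ z ∈ U, fderiv ℝ (fderiv ℝ ψ) z 1 1 + fderiv ℝ (fderiv ℝ ψ) z Complex.I Complex.I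
      = Q (ψ z, fderiv ℝ ψ z 1, fderiv ℝ ψ z Complex.I)) : ContDiffOn ℝ ∞ ψ U := by
  set φ : ℂ → CL4 := fun z =>
    ofRealL (fderiv ℝ ψ z 1) - Complex.I • ofRealL (fderiv ℝ ψ z Complex.I) with hφ
  -- With `φ = ψ_s - i ψ_t` one has `∂̄ψ = (ψ_s + i ψ_t) / 2`, half the conjugate of `φ`, and `∂̄φ =
  -- (ψ_ss + ψ_tt) / 2`, the mixed terms cancelling. Real and imaginary parts recover `ψ_s = Re φ`
  -- and `ψ_t = -Im φ`.
  let P : CL4 × CL4 → CL4 × CL4 := fun p =>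
    ((1 / 2 : ℂ) • (ofRealL (reL p.2) - Complex.I • ofRealL (imL p.2)),
      (1 / 2 : ℂ) • ofRealL (Q (reL p.1, reL p.2, -imL p.2)))
  have hP : ContDiff ℝ ∞ P := by
    have h1 : ContDiff ℝ ∞ fun p : CL4 × CL4 => Q (reL p.1, reL p.2, -imL p.2) :=
      hQ.comp (by fun_prop)
    have h2 : ContDiff ℝ ∞ fun p : CL4 × CL4 => ofRealL (reL p.2) := by fun_prop
    have h3 : ContDiff ℝ ∞ fun p : CL4 × CL4 => ofRealL (imL p.2) := by fun_prop
    exact ((h2.sub (h3.const_smul _)).const_smul _).prodMk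
      ((ofRealL.contDiff.comp h1).const_smul _)
  have hψ' : ContDiffOn ℝ 1 (fderiv ℝ ψ) U := hψ.fderiv_of_isOpen hU (by norm_num)
  have hφC : ContDiffOn ℝ 1 φ U :=
    (ofRealL.contDiff.comp_contDiffOn (hψ'.clm_apply contDiffOn_const)).sub
      ((ofRealL.contDiff.comp_contDiffOn (hψ'.clm_apply contDiffOn_const)).const_smul _)
  have hW : ContDiffOn ℝ 1 (fun z => (ofRealL (ψ z), φ z)) U :=
    (ofRealL.contDiff.comp_contDiffOn (hψ.of_le (by norm_num))).prodMk hφC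
  have hd : ∀ z ∈ U, dbar (fun z => (ofRealL (ψ z), φ z)) z = P (ofRealL (ψ z), φ z) := fun z hz => by
    have hz' := hU.mem_nhds hz
    have hψz : ContDiffAt ℝ 2 ψ z := hψ.contDiffAt hz'
    have hsymm : IsSymmSndFDerivAt ℝ ψ z := hψz.isSymmSndFDerivAt (by simp)
    have h2 := ((hψ'.differentiableOn one_ne_zero).differentiableAt hz').hasFDerivAt
    have h3 : ∀ v : ℂ, HasFDerivAt (fun y => fderiv ℝ ψ y v) ((fderiv ℝ (fderiv ℝ ψ) z).flip v) z :=
      fun v => by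
        refine (h2.clm_apply (hasFDerivAt_const v z)).congr_fderiv ?_
        ext w <;> simp
    have h4 := (ofRealL.hasFDerivAt.comp z (h3 1)).sub
      ((ofRealL.hasFDerivAt.comp z (h3 Complex.I)).const_smul Complex.I)
    have h5 := ofRealL.hasFDerivAt.comp z (hψz.differentiableAt two_ne_zero).hasFDerivAt
    have h6 : HasFDerivAt (fun z => (ofRealL (ψ z), φ z)) _ z := h5.prodMk h4
    rw [dbar, h6.fderiv]
    refine Prod.ext ?_ ?_
    · simp only [P, hφ, reL_ofRealL_sub, imL_ofRealL_sub]
      simp [dbarOf]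
    · simp only [P, hφ, reL_ofRealL_sub, imL_ofRealL_sub, reL_ofRealL, neg_neg]
      rw [← hΔ z hz, map_add]
      change (1 / 2 : ℂ) • ((ofRealL (fderiv ℝ (fderiv ℝ ψ) z 1 1)
          - Complex.I • ofRealL (fderiv ℝ (fderiv ℝ ψ) z 1 Complex.I))
        + Complex.I • (ofRealL (fderiv ℝ (fderiv ℝ ψ) z Complex.I 1)
          - Complex.I • ofRealL (fderiv ℝ (fderiv ℝ ψ) z Complex.I Complex.I))) = _
      rw [hsymm.eq 1 Complex.I, smul_sub, smul_smul, Complex.I_mul_I]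
      module
  have h := (contDiffOn_infty_of_dbar_eq hU hP hW hd).fst
  refine (reL.contDiff.comp_contDiffOn h).congr fun z _ => ?_
  exact (reL_ofRealL _).symm

/-! ### Lorentzian algebra and frames adapted to a conformal surface -/

theorem lor3_comm (x y : L3) : lor3 x y = lor3 y x := by simp only [lor3]; ring

theorem lor4_comm (x y : L4) : lor4 x y = lor4 y x := by simp only [lor4, lor3]; ring

theorem lor3_add_left (x y z : L3) : lor3 (x + y) z = lor3 x z + lor3 y z := by
  simp only [lor3, Pi.add_apply]; ring

theorem lor3_smul_left (c : ℝ) (x y : L3) : lor3 (c • x) y = c * lor3 x y := by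
  simp only [lor3, Pi.smul_apply, smul_eq_mul]; ring

theorem lor3_sub_left (x y z : L3) : lor3 (x - y) z = lor3 x z - lor3 y z := by
  simp only [lor3, Pi.sub_apply]; ring

theorem lor4_add_left (x y z : L4) : lor4 (x + y) z = lor4 x z + lor4 y z := by
  simp only [lor4, lor3, Prod.fst_add, Prod.snd_add, Pi.add_apply]; ring

theorem lor4_smul_left (c : ℝ) (x y : L4) : lor4 (c • x) y = c * lor4 x y := by
  simp only [lor4, lor3, Prod.smul_fst, Prod.smul_snd, Pi.smul_apply, smul_eq_mul]; ring

theorem lor4_sub_left (x y z : L4) : lor4 (x - y) z = lor4 x z - lor4 y z := by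
  simp only [lor4, lor3, Prod.fst_sub, Prod.snd_sub, Pi.sub_apply]; ring

theorem lor4_add_right (x y z : L4) : lor4 x (y + z) = lor4 x y + lor4 x z := by
  rw [lor4_comm, lor4_add_left, lor4_comm y, lor4_comm z]

theorem lor4_smul_right (c : ℝ) (x y : L4) : lor4 x (c • y) = c * lor4 x y := by
  rw [lor4_comm, lor4_smul_left, lor4_comm y]

theorem lor4_horizontal (x : L4) (n : L3) : lor4 x (n, 0) = lor3 x.1 n := by simp [lor4]

/-- The metric of `L4` as a bilinear map. -/
def lor4Lin : L4 →ₗ[ℝ] L4 →ₗ[ℝ] ℝ :=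
  LinearMap.mk₂ ℝ lor4 lor4_add_left lor4_smul_left lor4_add_right lor4_smul_right

/-- The metric of `L4` as a continuous bilinear map. -/
def lor4L : L4 →L[ℝ] L4 →L[ℝ] ℝ := lor4Lin.toContinuousBilinearMap

theorem continuousOn_lor4 {s : Set ℂ} {f g : ℂ → L4} (hf : ContinuousOn f s)
    (hg : ContinuousOn g s) : ContinuousOn (fun z => lor4 (f z) (g z)) s :=
  lor4L.continuous₂.comp_continuousOn (hf.prodMk hg)

theorem eq_zero_of_lor4_eq_zero {v : L4} (h : ∀ x, lor4 v x = 0) : v = 0 := by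
  have h0 := h (Pi.single 0 1, 0)
  have h1 := h (Pi.single 1 1, 0)
  have h2 := h (Pi.single 2 1, 0)
  have h3 := h (0, 1)
  simp [lor4, lor3] at h0 h1 h2 h3
  refine Prod.ext (funext fun i => ?_) h3
  fin_cases i <;> simp [h0, h1, h2]

/-- A vector orthogonal to four pairwise orthogonal, non-isotropic vectors vanishes. -/
theorem eq_zero_of_orthogonal {e : Fin 4 → L4} (ho : ∀ i j, i ≠ j → lor4 (e i) (e j) = 0)
    (hn : ∀ i, lor4 (e i) (e i) ≠ 0) {v : L4} (hv : ∀ i, lor4 v (e i) = 0) : v = 0 := by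
  have hli : LinearIndependent ℝ e :=
    LinearMap.linearIndependent_of_isOrthoᵢ (B := lor4Lin) (fun i j hij => ho i j hij)
      fun i h => hn i h
  have hspan : Submodule.span ℝ (Set.range e) = ⊤ :=
    hli.span_eq_top_of_card_eq_finrank (by simp)
  refine eq_zero_of_lor4_eq_zero fun x => ?_
  have hx : x ∈ Submodule.span ℝ (Set.range e) := hspan ▸ Submodule.mem_top
  have hle : Submodule.span ℝ (Set.range e) ≤ LinearMap.ker (lor4Lin v) :=
    Submodule.span_le.2 (by rintro _ ⟨i, rfl⟩; exact hv i)
  exact hle hx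

/-- An orthogonal frame `(n, 0), a, b, η` adapted to a conformal surface. -/
structure IsConformalFrame (n : L3) (a b η : L4) (lam : ℝ) : Prop where
  pos : 0 < lam
  nn : lor3 n n = -1
  an : lor3 a.1 n = 0
  bn : lor3 b.1 n = 0
  ηn : lor3 η.1 n = 0
  aa : lor4 a a = lam
  bb : lor4 b b = lam
  ab : lor4 a b = 0
  aη : lor4 a η = 0
  bη : lor4 b η = 0
  ηη : lor4 η η = 1

/-- Vector identities in `L4` can therefore be checked by pairing with the four frame vectors, even
though the metric is indefinite. -/
theorem IsConformalFrame.eq_zero {n : L3} {a b η : L4} {lam : ℝ} (h : IsConformalFrame n a b η lam)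
    {v : L4} (hn : lor3 v.1 n = 0) (ha : lor4 v a = 0) (hb : lor4 v b = 0) (hη : lor4 v η = 0) :
    v = 0 := by
  have hl := h.pos.ne'
  have hnn : lor4 ((n, 0) : L4) (n, 0) = -1 := by rw [lor4_horizontal]; exact h.nn
  have han : lor4 a (n, 0) = 0 := by rw [lor4_horizontal]; exact h.an
  have hbn : lor4 b (n, 0) = 0 := by rw [lor4_horizontal]; exact h.bn
  have hηn : lor4 η (n, 0) = 0 := by rw [lor4_horizontal]; exact h.ηn
  have hna := (lor4_comm (n, 0) a).trans han
  have hnb := (lor4_comm (n, 0) b).trans hbn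
  have hnη := (lor4_comm (n, 0) η).trans hηn
  have hba := (lor4_comm b a).trans h.ab
  have hηa := (lor4_comm η a).trans h.aη
  have hηb := (lor4_comm η b).trans h.bη
  have hab := h.ab
  have haη := h.aη
  have hbη := h.bη
  refine eq_zero_of_orthogonal (e := ![(n, 0), a, b, η]) (fun i j hij => ?_) (fun i => ?_)
    fun i => ?_
  · fin_cases i <;> fin_cases j <;> first | exact absurd rfl hij | assumption
  · fin_cases i
    · change lor4 ((n, 0) : L4) (n, 0) ≠ 0; rw [hnn]; norm_num
    · change lor4 a a ≠ 0; rw [h.aa]; exact hl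
    · change lor4 b b ≠ 0; rw [h.bb]; exact hl
    · change lor4 η η ≠ 0; rw [h.ηη]; norm_num
  · fin_cases i
    · change lor4 v (n, 0) = 0; rw [lor4_horizontal]; exact hn
    · exact ha
    · exact hb
    · exact hη

/-- The triple product of `(n, 0)`, `a` and `b` in `L4`. -/
def tripleProduct (n : L3) (a b : L4) : L4 :=
  (![-(n 1 * (a.1 2 * b.2 - a.2 * b.1 2) - n 2 * (a.1 1 * b.2 - a.2 * b.1 1)),
      -(n 0 * (a.1 2 * b.2 - a.2 * b.1 2) - n 2 * (a.1 0 * b.2 - a.2 * b.1 0)),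
      n 0 * (a.1 1 * b.2 - a.2 * b.1 1) - n 1 * (a.1 0 * b.2 - a.2 * b.1 0)],
    -(n 0 * (a.1 1 * b.1 2 - a.1 2 * b.1 1) - n 1 * (a.1 0 * b.1 2 - a.1 2 * b.1 0)
      + n 2 * (a.1 0 * b.1 1 - a.1 1 * b.1 0)))

theorem lor3_tripleProduct (n : L3) (a b : L4) : lor3 (tripleProduct n a b).1 n = 0 := by
  simp [tripleProduct, lor3]; ring

theorem lor4_tripleProduct_left (n : L3) (a b : L4) : lor4 (tripleProduct n a b) a = 0 := by
  simp [tripleProduct, lor3, lor4]; ring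

theorem lor4_tripleProduct_right (n : L3) (a b : L4) : lor4 (tripleProduct n a b) b = 0 := by
  simp [tripleProduct, lor3, lor4]; ring

/-- The right side is minus the Gram determinant of `(n, 0)`, `a`, `b`; the sign comes from the
Lorentzian signature. -/
theorem lor4_tripleProduct_self (n : L3) (a b : L4) :
    lor4 (tripleProduct n a b) (tripleProduct n a b) =
      -(lor3 n n * (lor4 a a * lor4 b b - lor4 a b ^ 2)
        - lor3 a.1 n * (lor3 a.1 n * lor4 b b - lor4 a b * lor3 b.1 n)
        + lor3 b.1 n * (lor3 a.1 n * lor4 a b - lor4 a a * lor3 b.1 n)) := by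
  simp [tripleProduct, lor3, lor4]; ring

theorem contDiff_tripleProduct :
    ContDiff ℝ ∞ fun q : L4 × L4 × L4 => tripleProduct q.1.1 q.2.1 q.2.2 := by
  unfold tripleProduct
  refine ContDiff.prodMk (contDiff_pi.2 fun i => ?_) (by fun_prop)
  fin_cases i <;> simp <;> fun_prop

theorem IsConformalFrame.tripleProduct_eq {n : L3} {a b η : L4} {lam : ℝ}
    (h : IsConformalFrame n a b η lam) :
    tripleProduct n a b = lor4 (tripleProduct n a b) η • η := by
  rw [← sub_eq_zero]
  refine h.eq_zero ?_ ?_ ?_ ?_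
  · rw [Prod.fst_sub, Prod.smul_fst, lor3_sub_left, lor3_smul_left, lor3_tripleProduct, h.ηn]; ring
  · rw [lor4_sub_left, lor4_smul_left, lor4_tripleProduct_left, lor4_comm η a, h.aη]; ring
  · rw [lor4_sub_left, lor4_smul_left, lor4_tripleProduct_right, lor4_comm η b, h.bη]; ring
  · rw [lor4_sub_left, lor4_smul_left, h.ηη]; ring

/-- In an adapted frame the Gram determinant is `-λ²`, so the triple product is `λ η` up to sign.
This expresses `λ η` through the 1-jet of the surface, with no regularity assumed of `η` beyond
continuity. -/
theorem IsConformalFrame.sq_eq {n : L3} {a b η : L4} {lam : ℝ}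
    (h : IsConformalFrame n a b η lam) : lor4 (tripleProduct n a b) η ^ 2 = lam ^ 2 := by
  have h1 := lor4_tripleProduct_self n a b
  rw [h.nn, h.an, h.bn, h.aa, h.bb, h.ab] at h1
  have h2 : lor4 (tripleProduct n a b) (tripleProduct n a b)
      = lor4 (tripleProduct n a b) η * lor4 (tripleProduct n a b) η := by
    nth_rw 2 [h.tripleProduct_eq]
    rw [lor4_smul_right]
  rw [h2] at h1
  linarith

/-- Differentiating an identity between inner products on a set with unique derivatives. -/
theorem lor4_deriv_eq {D : Set ℂ} {z : ℂ} (hD : UniqueDiffWithinAt ℝ D z) (hz : z ∈ D)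
    {f g h k : ℂ → L4} {f' g' h' k' : ℂ →L[ℝ] L4}
    (hf : HasFDerivWithinAt f f' D z) (hg : HasFDerivWithinAt g g' D z)
    (hh : HasFDerivWithinAt h h' D z) (hk : HasFDerivWithinAt k k' D z)
    (heq : ∀ ζ ∈ D, lor4 (f ζ) (g ζ) = lor4 (h ζ) (k ζ)) (v : ℂ) :
    lor4 (f z) (g' v) + lor4 (f' v) (g z) = lor4 (h z) (k' v) + lor4 (h' v) (k z) := by
  have h1 := lor4L.hasFDerivWithinAt_of_bilinear hf hg
  have h2 := (lor4L.hasFDerivWithinAt_of_bilinear hh hk).congr heq (heq z hz)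
  exact DFunLike.congr_fun (hD.eq h1 h2) v

/-! ### The equation of conformal surfaces with `H = 1/2` -/

section

variable {D : Set ℂ} {ψ η : ℂ → L4}

theorem firstForm_eq (hψ : IsConformalImmersionOn D ψ) {z : ℂ} (hz : z ∈ D) :
    0 < firstForm D ψ z 1 1 ∧ firstForm D ψ z Complex.I Complex.I = firstForm D ψ z 1 1 ∧
      firstForm D ψ z 1 Complex.I = 0 := by
  obtain ⟨lam, hpos, h⟩ := hψ.conformal z hz
  have h1 := h 1
  have hI := h Complex.I
  have h1I := h (1 + Complex.I)
  have hn : ‖1 + Complex.I‖ ^ 2 = 2 := by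
    rw [← Complex.normSq_eq_norm_sq, Complex.normSq_apply]; norm_num
  rw [map_add, lor4_add_left, lor4_add_right, lor4_add_right, hn,
    lor4_comm (fderivWithin ℝ ψ D z Complex.I) (fderivWithin ℝ ψ D z 1)] at h1I
  rw [norm_one] at h1
  rw [Complex.norm_I] at hI
  simp only [firstForm]
  refine ⟨by rw [h1]; linarith, by rw [h1, hI], by linarith⟩

theorem hasFDerivWithinAt_horizontal {z : ℂ} {ψ' : ℂ →L[ℝ] L4} (h : HasFDerivWithinAt ψ ψ' D z) :
    HasFDerivWithinAt (fun ζ => (((ψ ζ).1, 0) : L4))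
      (((ContinuousLinearMap.fst ℝ L3 ℝ).comp ψ').prod 0) D z :=
  ((ContinuousLinearMap.fst ℝ L3 ℝ).hasFDerivAt.comp_hasFDerivWithinAt z h).prodMk
    (hasFDerivWithinAt_const _ _ _)

theorem lor3_fderivWithin (hD : UniqueDiffOn ℝ D) (hψd : DifferentiableOn ℝ ψ D)
    (hψ : Set.MapsTo ψ D space) {z : ℂ} (hz : z ∈ D) (v : ℂ) :
    lor3 (fderivWithin ℝ ψ D z v).1 (ψ z).1 = 0 := by
  have h1 := hasFDerivWithinAt_horizontal (hψd z hz).hasFDerivWithinAt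
  have h := lor4_deriv_eq (hD z hz) hz h1 h1
    (hasFDerivWithinAt_const ((ψ z).1, 0) z D) (hasFDerivWithinAt_const ((ψ z).1, 0) z D)
    (fun ζ hζ => by
      rw [lor4_horizontal, lor4_horizontal]
      exact (hψ hζ).1.trans (hψ hz).1.symm) v
  simp only [lor4, lor3, ContinuousLinearMap.prod_apply, ContinuousLinearMap.comp_apply,
    ContinuousLinearMap.coe_fst', zero_apply] at h ⊢
  simp at h
  linarith

theorem isConformalFrame (hD : UniqueDiffOn ℝ D) (hψd : DifferentiableOn ℝ ψ D)
    (hψ : IsConformalImmersionOn D ψ) (hη : IsUnitNormalOn D ψ η) {z : ℂ} (hz : z ∈ D) :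
    IsConformalFrame (ψ z).1 (fderivWithin ℝ ψ D z 1) (fderivWithin ℝ ψ D z Complex.I) (η z)
      (firstForm D ψ z 1 1) := by
  obtain ⟨h1, h2, h3⟩ := firstForm_eq hψ hz
  exact
    { pos := h1
      nn := (hψ.mapsTo hz).1
      an := lor3_fderivWithin hD hψd hψ.mapsTo hz 1
      bn := lor3_fderivWithin hD hψd hψ.mapsTo hz Complex.I
      ηn := hη.tangent z hz
      aa := rfl
      bb := h2
      ab := h3
      aη := hη.normal z hz 1
      bη := hη.normal z hz Complex.I
      ηη := hη.unit z hz }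

/-- The equation `ψ_ss + ψ_tt = λ η + (⟨N_s, N_s⟩ + ⟨N_t, N_t⟩) (N, 0)` of conformal surfaces with
mean curvature `1/2` in `ℍ² × ℝ`. -/
theorem laplacian_eq (hD : UniqueDiffOn ℝ D) (hDc : D ⊆ closure (interior D))
    (hψ2 : ContDiffOn ℝ 2 ψ D) (hψ : IsConformalImmersionOn D ψ) (hη : IsUnitNormalOn D ψ η)
    {z : ℂ} (hz : z ∈ D) (hH : meanCurvature D ψ η z = 1 / 2) :
    fderivWithin ℝ (fderivWithin ℝ ψ D) D z 1 1
        + fderivWithin ℝ (fderivWithin ℝ ψ D) D z Complex.I Complex.I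
      = firstForm D ψ z 1 1 • η z
        + (lor3 (fderivWithin ℝ ψ D z 1).1 (fderivWithin ℝ ψ D z 1).1
          + lor3 (fderivWithin ℝ ψ D z Complex.I).1 (fderivWithin ℝ ψ D z Complex.I).1)
          • ((ψ z).1, 0) := by
  have hψd : DifferentiableOn ℝ ψ D := hψ2.differentiableOn two_ne_zero
  have hf := isConformalFrame hD hψd hψ hη hz
  have hA : DifferentiableOn ℝ (fderivWithin ℝ ψ D) D :=
    (hψ2.fderivWithin hD (m := 1) (by norm_num)).differentiableOn one_ne_zero
  have hsymm : IsSymmSndFDerivWithinAt ℝ ψ D z :=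
    (hψ2 z hz).isSymmSndFDerivWithinAt (by simp) hD (hDc hz) hz
  set A := fderivWithin ℝ ψ D with hAdef
  set B := fderivWithin ℝ A D z with hB
  have hAw : ∀ w : ℂ, HasFDerivWithinAt (fun ζ => A ζ w) (B.flip w) D z := fun w => by
    refine ((hA z hz).hasFDerivWithinAt.clm_apply (hasFDerivWithinAt_const w z D)).congr_fderiv ?_
    ext v <;> simp [hB]
  have h0 := hasFDerivWithinAt_const (𝕜 := ℝ) (0 : L4) z D
  have hN := hasFDerivWithinAt_horizontal (hψd z hz).hasFDerivWithinAt
  have hz0 : ∀ x : L4, lor4 0 x = 0 := fun x => by simp [lor4, lor3]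
  have hBs : B Complex.I 1 = B 1 Complex.I := hsymm.eq _ _
  -- tangency
  have e1 : ∀ w, lor3 (B w w).1 (ψ z).1 = -lor3 (A z w).1 (A z w).1 := fun w => by
    have h := lor4_deriv_eq (hD z hz) hz (hAw w) hN h0 h0 (fun ζ hζ => by
      rw [lor4_horizontal, hz0]
      exact lor3_fderivWithin hD hψd hψ.mapsTo hζ w) w
    rw [hz0] at h
    simp only [lor4_horizontal, ContinuousLinearMap.flip_apply, ContinuousLinearMap.prod_apply,
      ContinuousLinearMap.comp_apply, ContinuousLinearMap.coe_fst', zero_apply] at h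
    rw [hz0, lor3_comm (A z w).1] at h
    have h' : lor3 (A z w).1 (A z w).1 + lor3 (B w w).1 (ψ z).1 = 0 + 0 := by
      rw [← h]
    linarith
  -- conformality
  have e2 : ∀ v, lor4 (B v 1) (A z 1) = lor4 (B v Complex.I) (A z Complex.I) := fun v => by
    have h := lor4_deriv_eq (hD z hz) hz (hAw 1) (hAw 1) (hAw Complex.I) (hAw Complex.I)
      (fun ζ hζ => (firstForm_eq hψ hζ).2.1.symm) v
    simp only [ContinuousLinearMap.flip_apply] at h
    rw [lor4_comm (A z 1), lor4_comm (A z Complex.I)] at h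
    linarith
  have e3 : ∀ v, lor4 (B v 1) (A z Complex.I) = -lor4 (B v Complex.I) (A z 1) := fun v => by
    have h := lor4_deriv_eq (hD z hz) hz (hAw 1) (hAw Complex.I) h0 h0
      (fun ζ hζ => by rw [hz0]; exact (firstForm_eq hψ hζ).2.2) v
    simp only [ContinuousLinearMap.flip_apply, zero_apply, hz0] at h
    rw [lor4_comm (A z 1)] at h
    linarith
  -- mean curvature
  have e4 : lor4 (B 1 1) (η z) + lor4 (B Complex.I Complex.I) (η z) = firstForm D ψ z 1 1 := by
    obtain ⟨hp, h1, h2⟩ := firstForm_eq hψ hz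
    rw [meanCurvature, h1, h2] at hH
    have h3 : secondForm D ψ η z 1 1 = lor4 (B 1 1) (η z) := rfl
    have h4 : secondForm D ψ η z Complex.I Complex.I = lor4 (B Complex.I Complex.I) (η z) := rfl
    rw [h3, h4] at hH
    field_simp at hH
    nlinarith
  rw [← sub_eq_zero]
  have hηa := (lor4_comm (η z) (A z 1)).trans hf.aη
  have hηb := (lor4_comm (η z) (A z Complex.I)).trans hf.bη
  have hna : lor4 ((ψ z).1, 0) (A z 1) = 0 := by rw [lor4_comm, lor4_horizontal]; exact hf.an
  have hnb : lor4 ((ψ z).1, 0) (A z Complex.I) = 0 := by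
    rw [lor4_comm, lor4_horizontal]; exact hf.bn
  have hnη : lor4 ((ψ z).1, 0) (η z) = 0 := by rw [lor4_comm, lor4_horizontal]; exact hf.ηn
  -- Pairing with `(N, 0)` uses tangency to `ℍ² × ℝ`. Pairing with `ψ_s` and `ψ_t` gives zero by the
  -- differentiated conformality relations and `ψ_st = ψ_ts`. Pairing with `η` is the mean curvature
  -- condition.
  refine hf.eq_zero ?_ ?_ ?_ ?_
  · simp only [Prod.fst_sub, Prod.fst_add, Prod.smul_fst, lor3_sub_left, lor3_add_left,
      lor3_smul_left]
    rw [e1, e1, hf.ηn, hf.nn]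
    ring
  · rw [lor4_sub_left, lor4_add_left, lor4_add_left, lor4_smul_left, lor4_smul_left, hηa, hna,
      e2, ← hBs, ← neg_eq_iff_eq_neg.2 (e3 Complex.I)]
    ring
  · rw [lor4_sub_left, lor4_add_left, lor4_add_left, lor4_smul_left, lor4_smul_left, hηb, hnb,
      e3, ← e2, hBs]
    ring
  · rw [lor4_sub_left, lor4_add_left, lor4_add_left, lor4_smul_left, lor4_smul_left, hnη, hf.ηη, e4]
    ring

end

/-! ### Reflection of `C²` maps across the real axis -/

section

variable {E : Type*} [NormedAddCommGroup E] [NormedSpace ℝ E] {Ω : Set ℂ}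

/-- Complex conjugation as a continuous real linear map. -/
def conjL : ℂ →L[ℝ] ℂ := Complex.conjCLE

/-- The extension of `f` from the closed upper half plane which is equivariant with respect to
complex conjugation and the linear map `τ`. -/
def symmExtend (τ : E →L[ℝ] E) (f : ℂ → E) (z : ℂ) : E := if 0 ≤ z.im then f z else τ (f (conj z))

/-- The action of `τ` and of complex conjugation on differentials. -/
def conjAction (τ : E →L[ℝ] E) : (ℂ →L[ℝ] E) →L[ℝ] (ℂ →L[ℝ] E) :=
  (ContinuousLinearMap.compL ℝ ℂ E E τ).comp ((ContinuousLinearMap.compL ℝ ℂ ℂ E).flip conjL)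

theorem conjAction_apply (τ : E →L[ℝ] E) (A : ℂ →L[ℝ] E) (v : ℂ) :
    conjAction τ A v = τ (A (conj v)) := rfl

theorem symmExtend_of_nonneg (τ : E →L[ℝ] E) (f : ℂ → E) {z : ℂ} (h : 0 ≤ z.im) :
    symmExtend τ f z = f z := if_pos h

theorem symmExtend_of_neg (τ : E →L[ℝ] E) (f : ℂ → E) {z : ℂ} (h : z.im < 0) :
    symmExtend τ f z = τ (f (conj z)) := if_neg (not_le.2 h)

theorem symmExtend_of_nonpos {τ : E →L[ℝ] E} {f : ℂ → E}
    (h0 : ∀ z ∈ Ω, z.im = 0 → τ (f z) = f z) {z : ℂ} (hz : z ∈ Ω) (h : z.im ≤ 0) :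
    symmExtend τ f z = τ (f (conj z)) := by
  rcases h.lt_or_eq with h | h
  · exact symmExtend_of_neg τ f h
  · rw [symmExtend_of_nonneg τ f h.ge, Complex.conj_eq_iff_im.2 h, h0 z hz h]

theorem upperPart_eq (Ω : Set ℂ) : upperPart Ω = Ω ∩ {z | 0 ≤ z.im} := rfl

theorem interior_upperPart (hΩ : IsOpen Ω) : interior (upperPart Ω) = Ω ∩ {z | 0 < z.im} := by
  rw [upperPart_eq, interior_inter, hΩ.interior_eq, Complex.interior_setOfPred_le_im]

/-- This gives symmetry of second derivatives at the boundary points of the half domain. -/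
theorem upperPart_subset_closure_interior (hΩ : IsOpen Ω) :
    upperPart Ω ⊆ closure (interior (upperPart Ω)) := by
  rw [interior_upperPart hΩ]
  refine Set.Subset.trans ?_ hΩ.inter_closure
  rw [Complex.closure_setOfPred_lt_im]
  exact fun z hz => hz

theorem uniqueDiffOn_upperPart (hΩ : IsOpen Ω) : UniqueDiffOn ℝ (upperPart Ω) := by
  have h : UniqueDiffOn ℝ {z : ℂ | 0 ≤ z.im} := by
    refine uniqueDiffOn_convex ((convex_Ici (0 : ℝ)).linear_preimage Complex.imLm) ?_
    have h1 := Complex.interior_setOfPred_le_im 0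
    exact ⟨Complex.I, by
      rw [h1]; simp⟩
  rw [upperPart_eq, Set.inter_comm]
  exact h.inter hΩ

theorem upperPart_mem_nhds (hΩ : IsOpen Ω) {z : ℂ} (hz : z ∈ Ω) (h : 0 < z.im) :
    upperPart Ω ∈ 𝓝 z := by
  refine mem_interior_iff_mem_nhds.1 ?_
  rw [interior_upperPart hΩ]
  exact ⟨hz, h⟩

theorem conj_mem_upperPart (hs : ∀ z ∈ Ω, conj z ∈ Ω) {z : ℂ} (hz : z ∈ Ω) (h : z.im ≤ 0) :
    conj z ∈ upperPart Ω := ⟨hs z hz, by rw [Complex.conj_im]; linarith⟩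

theorem continuousOn_symmExtend (hs : ∀ z ∈ Ω, conj z ∈ Ω) {τ : E →L[ℝ] E} {f : ℂ → E}
    (hf : ContinuousOn f (upperPart Ω)) (h0 : ∀ z ∈ Ω, z.im = 0 → τ (f z) = f z) :
    ContinuousOn (symmExtend τ f) Ω := by
  unfold symmExtend
  refine ContinuousOn.if (fun a ha => ?_) ?_ ?_
  · have h := ha.2
    rw [Complex.frontier_setOfPred_le_im] at h
    rw [Complex.conj_eq_iff_im.2 h, h0 a ha.1 h]
  · have hc : IsClosed {z : ℂ | 0 ≤ z.im} := isClosed_le continuous_const Complex.continuous_im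
    rw [hc.closure_eq]
    exact hf
  · simp only [not_le]
    rw [Complex.closure_setOfPred_im_lt]
    refine τ.continuous.comp_continuousOn (hf.comp Complex.continuous_conj.continuousOn ?_)
    exact fun z hz => conj_mem_upperPart hs hz.1 hz.2

/-- A linear relation satisfied by `f` on the real axis passes to its derivative along the axis. -/
theorem map_fderivWithin_one_eq_zero {E' : Type*} [NormedAddCommGroup E'] [NormedSpace ℝ E']
    (hΩ : IsOpen Ω) {f : ℂ → E} (T : E →L[ℝ] E') (hT : ∀ z ∈ Ω, z.im = 0 → T (f z) = 0) {z : ℂ}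
    (hz : z ∈ Ω) (h : z.im = 0) (hf : DifferentiableWithinAt ℝ f (upperPart Ω) z) :
    T (fderivWithin ℝ f (upperPart Ω) z 1) = 0 := by
  have hγ : HasDerivAt (fun t : ℝ => z + t) 1 0 := by
    simpa using (Complex.ofRealCLM.hasDerivAt (x := 0)).const_add z
  have hev : ∀ᶠ t : ℝ in 𝓝 0, z + t ∈ Ω := by
    refine hγ.continuousAt.eventually ?_
    simpa using hΩ.mem_nhds hz
  have h1 : HasDerivAt (fun t : ℝ => T (f (z + t))) (T (fderivWithin ℝ f (upperPart Ω) z 1)) 0 := by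
    refine T.hasFDerivAt.comp_hasDerivAt 0 (HasFDerivWithinAt.comp_hasDerivAt_of_eq 0
      hf.hasFDerivWithinAt hγ ?_ (by simp))
    filter_upwards [hev] with t ht
    exact ⟨ht, by simp [h]⟩
  have h2 : (fun t : ℝ => T (f (z + t))) =ᶠ[𝓝 0] fun _ => 0 := by
    filter_upwards [hev] with t ht
    exact hT _ ht (by simp [h])
  exact h1.unique ((hasDerivAt_const 0 (0 : E')).congr_of_eventuallyEq h2)

theorem map_fderivWithin_one (hΩ : IsOpen Ω) {τ : E →L[ℝ] E} {f : ℂ → E}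
    (h0 : ∀ z ∈ Ω, z.im = 0 → τ (f z) = f z) {z : ℂ} (hz : z ∈ Ω) (h : z.im = 0)
    (hf : DifferentiableWithinAt ℝ f (upperPart Ω) z) :
    τ (fderivWithin ℝ f (upperPart Ω) z 1) = fderivWithin ℝ f (upperPart Ω) z 1 := by
  have := map_fderivWithin_one_eq_zero hΩ (τ - ContinuousLinearMap.id ℝ E)
    (fun z hz h => by simp [h0 z hz h]) hz h hf
  simpa [sub_eq_zero] using this

theorem clm_ext_one_I {A B : ℂ →L[ℝ] E} (h1 : A 1 = B 1) (hI : A Complex.I = B Complex.I) :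
    A = B := by
  refine ContinuousLinearMap.ext fun v => ?_
  have hv : v = v.re • (1 : ℂ) + v.im • Complex.I := by simp [Complex.re_add_im]
  rw [hv, map_add, map_add, map_smul, map_smul, map_smul, map_smul, h1, hI]

theorem conjAction_eq_of {τ : E →L[ℝ] E} {A : ℂ →L[ℝ] E} (h1 : τ (A 1) = A 1)
    (hI : τ (A Complex.I) = -A Complex.I) : conjAction τ A = A := by
  refine clm_ext_one_I ?_ ?_
  · simp [conjAction_apply, h1]
  · simp [conjAction_apply, hI]

/-- The differential of an equivariant extension is the equivariant extension of the differential,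
for the induced action `conjAction τ`. The lemma can thus be applied again to the derivative. -/
theorem hasFDerivAt_symmExtend (hΩ : IsOpen Ω) (hs : ∀ z ∈ Ω, conj z ∈ Ω) {τ : E →L[ℝ] E}
    {f : ℂ → E} (hf : DifferentiableOn ℝ f (upperPart Ω))
    (h0 : ∀ z ∈ Ω, z.im = 0 → τ (f z) = f z)
    (hA : ∀ z ∈ Ω, z.im = 0 → conjAction τ (fderivWithin ℝ f (upperPart Ω) z)
      = fderivWithin ℝ f (upperPart Ω) z) {z : ℂ} (hz : z ∈ Ω) :
    HasFDerivAt (symmExtend τ f)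
      (symmExtend (conjAction τ) (fderivWithin ℝ f (upperPart Ω)) z) z := by
  set A := fderivWithin ℝ f (upperPart Ω)
  have hup : 0 ≤ z.im → HasFDerivWithinAt (symmExtend τ f) (A z) (upperPart Ω) z := fun h =>
    ((hf z ⟨hz, h⟩).hasFDerivWithinAt).congr (fun y hy => symmExtend_of_nonneg τ f hy.2)
      (symmExtend_of_nonneg τ f h)
  have hlow : z.im ≤ 0 → HasFDerivWithinAt (symmExtend τ f) (conjAction τ (A (conj z)))
      (Ω ∩ {y | y.im ≤ 0}) z := fun h => by
    have h1 := (hf _ (conj_mem_upperPart hs hz h)).hasFDerivWithinAt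
    have h2 : HasFDerivWithinAt (fun y : ℂ => conj y) conjL (Ω ∩ {y | y.im ≤ 0}) z :=
      conjL.hasFDerivWithinAt
    have h3 := τ.hasFDerivAt.comp_hasFDerivWithinAt z
      (h1.comp z h2 fun y hy => conj_mem_upperPart hs hy.1 hy.2)
    exact h3.congr (fun y hy => symmExtend_of_nonpos h0 hy.1 hy.2) (symmExtend_of_nonpos h0 hz h)
  rcases lt_trichotomy z.im 0 with h | h | h
  · rw [symmExtend_of_neg _ _ h]
    refine (hlow h.le).hasFDerivAt (inter_mem (hΩ.mem_nhds hz) ?_)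
    filter_upwards [(isOpen_lt Complex.continuous_im continuous_const).mem_nhds h] with y hy
    exact le_of_lt hy
  · rw [symmExtend_of_nonneg _ _ h.ge]
    have h1 := hlow h.le
    rw [Complex.conj_eq_iff_im.2 h, hA z hz h] at h1
    -- At a real point the two one-sided derivatives coincide by `hA`, and the two closed halves
    -- together cover a neighbourhood.
    refine ((hup h.ge).union h1).hasFDerivAt ?_
    filter_upwards [hΩ.mem_nhds hz] with y hy
    rcases le_total 0 y.im with h' | h'
    · exact Or.inl ⟨hy, h'⟩
    · exact Or.inr ⟨hy, h'⟩
  · rw [symmExtend_of_nonneg _ _ h.le]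
    exact (hup h.le).hasFDerivAt (upperPart_mem_nhds hΩ hz h)

/-- A `C²` reflection principle: the compatibility conditions on the real axis are stated for
the normal derivative `f_t` and for `f_tt`. -/
theorem symmExtend_derivatives (hΩ : IsOpen Ω) (hs : ∀ z ∈ Ω, conj z ∈ Ω) {τ : E →L[ℝ] E}
    {f : ℂ → E} (hf : ContDiffOn ℝ 2 f (upperPart Ω))
    (h0 : ∀ z ∈ Ω, z.im = 0 → τ (f z) = f z)
    (h1 : ∀ z ∈ Ω, z.im = 0 → τ (fderivWithin ℝ f (upperPart Ω) z Complex.I)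
      = -fderivWithin ℝ f (upperPart Ω) z Complex.I)
    (h2 : ∀ z ∈ Ω, z.im = 0 →
      τ (fderivWithin ℝ (fderivWithin ℝ f (upperPart Ω)) (upperPart Ω) z Complex.I Complex.I)
        = fderivWithin ℝ (fderivWithin ℝ f (upperPart Ω)) (upperPart Ω) z Complex.I Complex.I) :
    (∀ z ∈ Ω, HasFDerivAt (symmExtend τ f)
      (symmExtend (conjAction τ) (fderivWithin ℝ f (upperPart Ω)) z) z) ∧
    (∀ z ∈ Ω, HasFDerivAt (symmExtend (conjAction τ) (fderivWithin ℝ f (upperPart Ω)))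
      (symmExtend (conjAction (conjAction τ))
        (fderivWithin ℝ (fderivWithin ℝ f (upperPart Ω)) (upperPart Ω)) z) z) ∧
    ContDiffOn ℝ 2 (symmExtend τ f) Ω := by
  have hD := uniqueDiffOn_upperPart hΩ
  have hfd : DifferentiableOn ℝ f (upperPart Ω) := hf.differentiableOn two_ne_zero
  have hA1 : ContDiffOn ℝ 1 (fderivWithin ℝ f (upperPart Ω)) (upperPart Ω) :=
    hf.fderivWithin hD (m := 1) (by norm_num)
  have hAd : DifferentiableOn ℝ (fderivWithin ℝ f (upperPart Ω)) (upperPart Ω) :=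
    hA1.differentiableOn one_ne_zero
  set A := fderivWithin ℝ f (upperPart Ω) with hAdef
  have hBc : ContinuousOn (fderivWithin ℝ A (upperPart Ω)) (upperPart Ω) :=
    hA1.continuousOn_fderivWithin hD (by norm_num)
  set B := fderivWithin ℝ A (upperPart Ω) with hBdef
  have hA : ∀ z ∈ Ω, z.im = 0 → conjAction τ (A z) = A z := fun z hz h =>
    conjAction_eq_of (map_fderivWithin_one hΩ h0 hz h (hfd z ⟨hz, h.ge⟩)) (h1 z hz h)
  have hB : ∀ z ∈ Ω, z.im = 0 → conjAction (conjAction τ) (B z) = B z := fun z hz h => by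
    have hzD : z ∈ upperPart Ω := ⟨hz, h.ge⟩
    have hB1 : conjAction τ (B z 1) = B z 1 := map_fderivWithin_one hΩ hA hz h (hAd z hzD)
    have hsymm : B z Complex.I 1 = B z 1 Complex.I :=
      ((hf z hzD).isSymmSndFDerivWithinAt (by simp) hD
        (upperPart_subset_closure_interior hΩ hzD) hzD).eq _ _
    refine conjAction_eq_of hB1 ?_
    -- Differentiating the first order condition along the axis settles `f_ss` and `f_st`. Symmetry
    -- carries the result to `f_ts`, so only `f_tt` needs the hypothesis `h2`.
    have hB1I := DFunLike.congr_fun hB1 Complex.I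
    rw [conjAction_apply, Complex.conj_I, map_neg, map_neg] at hB1I
    refine clm_ext_one_I ?_ ?_
    · rw [conjAction_apply, map_one, hsymm, neg_apply, hsymm]
      exact neg_eq_iff_eq_neg.1 hB1I
    · rw [conjAction_apply, Complex.conj_I, map_neg, map_neg, neg_apply, h2 z hz h]
  have hd1 := fun z (hz : z ∈ Ω) => hasFDerivAt_symmExtend hΩ hs hfd h0 hA hz
  have hd2 := fun z (hz : z ∈ Ω) => hasFDerivAt_symmExtend hΩ hs hAd hA hB hz
  refine ⟨hd1, hd2, ?_⟩
  have e1 : ∀ z ∈ Ω, fderiv ℝ (symmExtend τ f) z = symmExtend (conjAction τ) A z :=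
    fun z hz => (hd1 z hz).fderiv
  have e2 : ∀ z ∈ Ω, fderiv ℝ (symmExtend (conjAction τ) A) z
      = symmExtend (conjAction (conjAction τ)) B z := fun z hz => (hd2 z hz).fderiv
  rw [show (2 : WithTop ℕ∞) = 1 + 1 by norm_num, contDiffOn_succ_iff_fderiv_of_isOpen hΩ]
  refine ⟨fun z hz => (hd1 z hz).differentiableAt.differentiableWithinAt, by simp, ?_⟩
  refine ContDiffOn.congr ?_ e1
  rw [show (1 : WithTop ℕ∞) = 0 + 1 by norm_num, contDiffOn_succ_iff_fderiv_of_isOpen hΩ]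
  refine ⟨fun z hz => (hd2 z hz).differentiableAt.differentiableWithinAt, by simp, ?_⟩
  exact (contDiffOn_zero.2 (continuousOn_symmExtend hs hBc hB)).congr e2

end

/-! ### Interior smoothness -/

/-- A conformal `C²` immersion with mean curvature `1/2` is smooth. -/
theorem contDiffOn_infty_of_meanCurvature {Ω : Set ℂ} (hΩ : IsOpen Ω) {ψ η : ℂ → L4}
    (hψ2 : ContDiffOn ℝ 2 ψ Ω) (hψ : IsConformalImmersionOn Ω ψ) (hη : IsUnitNormalOn Ω ψ η)
    (hH : ∀ z ∈ Ω, meanCurvature Ω ψ η z = 1 / 2) : ContDiffOn ℝ ∞ ψ Ω := by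
  intro z₀ hz₀
  obtain ⟨r, hr, hU⟩ := Metric.isOpen_iff.1 hΩ z₀ hz₀
  set U := Metric.ball z₀ r with hUdef
  have hUo : IsOpen U := Metric.isOpen_ball
  have hD := hΩ.uniqueDiffOn (𝕜 := ℝ)
  have hψd : DifferentiableOn ℝ ψ Ω := hψ2.differentiableOn two_ne_zero
  have hAc : ContinuousOn (fderivWithin ℝ ψ Ω) Ω := hψ2.continuousOn_fderivWithin hD (by norm_num)
  have hAv : ∀ v : ℂ, ContinuousOn (fun z => fderivWithin ℝ ψ Ω z v) Ω := fun v =>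
    hAc.clm_apply continuousOn_const
  set X : ℂ → L4 := fun z =>
    tripleProduct (ψ z).1 (fderivWithin ℝ ψ Ω z 1) (fderivWithin ℝ ψ Ω z Complex.I) with hX
  have hXc : ContinuousOn X Ω := contDiff_tripleProduct.continuous.comp_continuousOn
    (hψ2.continuousOn.prodMk ((hAv 1).prodMk (hAv Complex.I)))
  have hfr := fun z (hz : z ∈ Ω) => isConformalFrame hD hψd hψ hη hz
  -- The pairing of the triple product with `η` is continuous and equals `λ` or `-λ` at each point.
  -- On a ball, which is connected, the sign is constant.
  have hsign : Set.EqOn (fun z => lor4 (X z) (η z)) (fun z => firstForm Ω ψ z 1 1) U ∨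
      Set.EqOn (fun z => lor4 (X z) (η z)) (-fun z => firstForm Ω ψ z 1 1) U :=
    (convex_ball z₀ r).isPreconnected.eq_or_eq_neg_of_sq_eq
      ((continuousOn_lor4 hXc hη.continuousOn).mono hU)
      ((continuousOn_lor4 (hAv 1) (hAv 1)).mono hU)
      (fun z hz => (hfr z (hU hz)).sq_eq) fun hz => (hfr _ (hU hz)).pos.ne'
  obtain ⟨ε, hε⟩ : ∃ ε : ℝ, ∀ z ∈ U, firstForm Ω ψ z 1 1 • η z = ε • X z := by
    rcases hsign with h | h
    · refine ⟨1, fun z hz => ?_⟩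
      have h1 : lor4 (X z) (η z) = firstForm Ω ψ z 1 1 := h hz
      rw [one_smul, ← h1]
      exact (hfr z (hU hz)).tripleProduct_eq.symm
    · refine ⟨-1, fun z hz => ?_⟩
      have h1 : lor4 (X z) (η z) = -firstForm Ω ψ z 1 1 := h hz
      rw [show X z = lor4 (X z) (η z) • η z from (hfr z (hU hz)).tripleProduct_eq, h1]
      module
  let Q : L4 × L4 × L4 → L4 := fun q => ε • tripleProduct q.1.1 q.2.1 q.2.2
    + (lor3 q.2.1.1 q.2.1.1 + lor3 q.2.2.1 q.2.2.1) • (q.1.1, 0)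
  have hQ : ContDiff ℝ ∞ Q := by
    have h1 : ContDiff ℝ ∞ fun q : L4 × L4 × L4 =>
        lor3 q.2.1.1 q.2.1.1 + lor3 q.2.2.1 q.2.2.1 := by
      unfold lor3
      fun_prop
    have h2 : ContDiff ℝ ∞ fun q : L4 × L4 × L4 => ((q.1.1, 0) : L4) := by fun_prop
    exact (contDiff_tripleProduct.const_smul ε).add (h1.smul h2)
  have hA : ∀ z ∈ Ω, fderivWithin ℝ ψ Ω z = fderiv ℝ ψ z := fun z hz => fderivWithin_of_isOpen hΩ hz
  have hB : ∀ z ∈ Ω, fderivWithin ℝ (fderivWithin ℝ ψ Ω) Ω z = fderiv ℝ (fderiv ℝ ψ) z :=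
    fun z hz => by
      rw [fderivWithin_congr hA (hA z hz), fderivWithin_of_isOpen hΩ hz]
  have hmain : ContDiffOn ℝ ∞ ψ U := by
    refine contDiffOn_infty_of_laplacian_eq hUo hQ (hψ2.mono hU) fun z hz => ?_
    have h := laplacian_eq hD (hΩ.interior_eq.symm ▸ subset_closure) hψ2 hψ hη (hU hz)
      (hH z (hU hz))
    rw [hε z hz, hB z (hU hz)] at h
    simp only [hX, hA z (hU hz)] at h
    exact h
  exact (hmain.contDiffAt (hUo.mem_nhds (Metric.mem_ball_self hr))).contDiffWithinAt

/-! ### The reflection of `ℍ² × ℝ` in a vertical plane -/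

section

variable {p w : L3}

theorem lor3_reflection (h : IsUnitTangent p w) (x y : L4) :
    lor3 (reflection p w x).1 (reflection p w y).1 = lor3 x.1 y.1 := by
  obtain ⟨⟨hp, -⟩, hpw, hw⟩ := h
  have e : lor3 (reflection p w x).1 (reflection p w y).1 - lor3 x.1 y.1
      = 4 * (lor3 x.1 p * lor3 y.1 p) * (lor3 p p + 1)
        - 4 * (lor3 x.1 p * lor3 y.1 w + lor3 x.1 w * lor3 y.1 p) * lor3 p w
        + 4 * (lor3 x.1 w * lor3 y.1 w) * (lor3 w w - 1) := by
    simp only [reflection, lor3, Pi.sub_apply, Pi.smul_apply, Pi.add_apply, smul_eq_mul]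
    ring
  rw [hp, hpw, hw] at e
  linarith

theorem lor4_reflection (h : IsUnitTangent p w) (x y : L4) :
    lor4 (reflection p w x) (reflection p w y) = lor4 x y := by
  rw [lor4, lor4, lor3_reflection h]; rfl

theorem lor3_reflection_base (h : IsUnitTangent p w) (x : L4) :
    lor3 (reflection p w x).1 p = lor3 x.1 p := by
  obtain ⟨⟨hp, -⟩, hpw, -⟩ := h
  have e : lor3 (reflection p w x).1 p - lor3 x.1 p
      = -2 * lor3 x.1 p * (lor3 p p + 1) + 2 * lor3 x.1 w * lor3 p w := by
    simp only [reflection, lor3, Pi.sub_apply, Pi.smul_apply, Pi.add_apply, smul_eq_mul]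
    ring
  rw [hp, hpw] at e
  linarith

theorem lor3_reflection_velocity (h : IsUnitTangent p w) (x : L4) :
    lor3 (reflection p w x).1 w = lor3 x.1 w := by
  obtain ⟨-, hpw, hw⟩ := h
  have e : lor3 (reflection p w x).1 w - lor3 x.1 w
      = -2 * lor3 x.1 p * lor3 p w + 2 * lor3 x.1 w * (lor3 w w - 1) := by
    simp only [reflection, lor3, Pi.sub_apply, Pi.smul_apply, Pi.add_apply, smul_eq_mul]
    ring
  rw [hpw, hw] at e
  linarith

theorem reflection_reflection (h : IsUnitTangent p w) (x : L4) :
    reflection p w (reflection p w x) = x := by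
  refine Prod.ext ?_ rfl
  rw [reflection, lor3_reflection_base h, lor3_reflection_velocity h]
  simp only [reflection]
  abel

theorem reflection_eq_self (h : IsUnitTangent p w) {x : L4} {a b : ℝ} (hx : x.1 = a • p + b • w) :
    reflection p w x = x := by
  obtain ⟨⟨hp, -⟩, hpw, hw⟩ := h
  refine Prod.ext ?_ rfl
  have h1 : lor3 x.1 p = -a := by
    rw [hx, lor3_add_left, lor3_smul_left, lor3_smul_left, hp, lor3_comm w p, hpw]; ring
  have h2 : lor3 x.1 w = b := by
    rw [hx, lor3_add_left, lor3_smul_left, lor3_smul_left, hw, hpw]; ring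
  simp only [reflection]
  rw [h1, h2, hx]
  module

theorem reflection_of_mem_verticalPlane (h : IsUnitTangent p w) {x : L4}
    (hx : x ∈ verticalPlane p w) : reflection p w x = x := by
  obtain ⟨r, hr⟩ := hx
  exact reflection_eq_self h hr.symm

theorem reflection_of_mem_verticalPlaneTangent (h : IsUnitTangent p w) {x ξ : L4}
    (hξ : ξ ∈ verticalPlaneTangent p w x) : reflection p w ξ = ξ := by
  obtain ⟨r, a, -, hξ⟩ := hξ
  refine reflection_eq_self h (a := a * Real.sinh r) (b := a * Real.cosh r) ?_
  rw [hξ, geodesicVelocity, smul_add, smul_smul, smul_smul]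

/-- Reversed Cauchy-Schwarz inequality for timelike vectors of the same sheet; the square `(x₁ y₂ -
x₂ y₁)²` measures the defect in the Euclidean inequality for the spatial parts. -/
theorem lor3_neg_of_mem {x y : L3} (hx : x ∈ hyperbolicPlane) (hy : y ∈ hyperbolicPlane) :
    lor3 x y < 0 := by
  obtain ⟨hx1, hx0⟩ := hx
  obtain ⟨hy1, hy0⟩ := hy
  simp only [lor3] at *
  by_contra hcon
  have h1 : x 0 * y 0 ≤ x 1 * y 1 + x 2 * y 2 := by linarith
  have h2 : 0 < x 0 * y 0 := mul_pos hx0 hy0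
  have h3 : (x 0 * y 0) ^ 2 ≤ (x 1 * y 1 + x 2 * y 2) ^ 2 := by gcongr
  have hx2 : x 0 ^ 2 = 1 + x 1 ^ 2 + x 2 ^ 2 := by linarith
  have hy2 : y 0 ^ 2 = 1 + y 1 ^ 2 + y 2 ^ 2 := by linarith
  rw [mul_pow, hx2, hy2] at h3
  nlinarith [sq_nonneg (x 1 * y 2 - x 2 * y 1), sq_nonneg (x 1), sq_nonneg (x 2), sq_nonneg (y 1),
    sq_nonneg (y 2)]

/-- The sign of the pairing with a point of the upper sheet tells the two sheets apart. As the
reflection preserves the pairing with `p`, it preserves the upper sheet. -/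
theorem mem_hyperbolicPlane_of_lor3_neg {x y : L3} (hx : lor3 x x = -1) (hy : y ∈ hyperbolicPlane)
    (hxy : lor3 x y < 0) : x ∈ hyperbolicPlane := by
  refine ⟨hx, ?_⟩
  rcases lt_trichotomy (x 0) 0 with h | h | h
  · have h1 : -x ∈ hyperbolicPlane := ⟨by simpa [lor3] using hx, by simpa using h⟩
    have h2 := lor3_neg_of_mem h1 hy
    simp only [lor3, Pi.neg_apply] at h2 hxy
    linarith
  · simp only [lor3, h] at hx
    nlinarith [sq_nonneg (x 1), sq_nonneg (x 2)]
  · exact h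

theorem reflection_mem_space (h : IsUnitTangent p w) {x : L4} (hx : x ∈ space) :
    reflection p w x ∈ space := by
  refine mem_hyperbolicPlane_of_lor3_neg ((lor3_reflection h x x).trans hx.1) h.1 ?_
  rw [lor3_reflection_base h]
  exact lor3_neg_of_mem hx h.1

/-- The reflection as a continuous linear map. -/
def reflectionL (p w : L3) : L4 →L[ℝ] L4 :=
  LinearMap.toContinuousLinearMap
    { toFun := reflection p w
      map_add' := fun x y => by
        simp only [reflection, Prod.fst_add, Prod.snd_add, lor3_add_left, Prod.mk_add_mk]
        congr 1
        module
      map_smul' := fun c x => by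
        simp only [reflection, Prod.smul_fst, Prod.smul_snd, lor3_smul_left, RingHom.id_apply,
          Prod.smul_mk]
        congr 1
        module }

theorem reflectionL_apply (x : L4) : reflectionL p w x = reflection p w x := rfl

/-- The unit normal of the geodesic through `p` with velocity `w`. -/
def geodesicNormal (p w : L3) : L3 :=
  ![-(p 1 * w 2 - p 2 * w 1), p 2 * w 0 - p 0 * w 2, p 0 * w 1 - p 1 * w 0]

theorem lor3_geodesicNormal_self (h : IsUnitTangent p w) :
    lor3 (geodesicNormal p w) (geodesicNormal p w) = 1 := by
  obtain ⟨⟨hp, -⟩, hpw, hw⟩ := h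
  have e : lor3 (geodesicNormal p w) (geodesicNormal p w)
      = -(lor3 p p * lor3 w w - lor3 p w ^ 2) := by
    simp [geodesicNormal, lor3]; ring
  rw [e, hp, hpw, hw]; norm_num

theorem lor3_reflection_geodesicNormal (x : L4) :
    lor3 (reflection p w x).1 (geodesicNormal p w) = -lor3 x.1 (geodesicNormal p w) := by
  simp [geodesicNormal, lor3, reflection]; ring

/-- In an adapted frame at a point of the vertical plane, if the other three vectors are fixed by
the reflection, then the fourth one is reversed. -/
theorem reflection_eq_neg (h : IsUnitTangent p w) {n : L3} {a b η : L4} {lam : ℝ}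
    (hf : IsConformalFrame n a b η lam) (hn : reflection p w (n, 0) = (n, 0))
    (ha : reflection p w a = a) (hη : reflection p w η = η) : reflection p w b = -b := by
  have hfix : ∀ x : L4, reflection p w x = x → lor3 x.1 (geodesicNormal p w) = 0 := fun x hx => by
    have := lor3_reflection_geodesicNormal (p := p) (w := w) x
    rw [hx] at this
    linarith
  have hsum : ∀ x, reflection p w x = x → lor4 b x = 0 → lor4 (reflection p w b + b) x = 0 :=
    fun x hx hbx => by
      rw [lor4_add_left, hbx]
      nth_rw 1 [← hx]
      rw [lor4_reflection h, hbx, add_zero]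
  -- The normal of the plane is scaled to length `√lam` so that it can replace `b` in the frame. The
  -- vector `σ b + b` is orthogonal to the fixed vectors since `σ` is an isometry, and to `ν` since
  -- `σ` changes the sign of the pairing with `ν`.
  set ν : L4 := √lam • (geodesicNormal p w, 0) with hν
  have hxν : ∀ x : L4, lor4 x ν = √lam * lor3 x.1 (geodesicNormal p w) := fun x => by
    rw [hν, lor4_smul_right, lor4_horizontal]
  have hframe : IsConformalFrame n a ν η lam :=
    { pos := hf.pos
      nn := hf.nn
      an := hf.an
      bn := by
        rw [hν, Prod.smul_fst, lor3_smul_left, lor3_comm, hfix (n, 0) hn, mul_zero]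
      ηn := hf.ηn
      aa := hf.aa
      bb := by
        rw [hxν, hν, Prod.smul_fst, lor3_smul_left, lor3_geodesicNormal_self h, mul_one,
          Real.mul_self_sqrt hf.pos.le]
      ab := by rw [hxν, hfix a ha, mul_zero]
      aη := hf.aη
      bη := by rw [lor4_comm, hxν, hfix η hη, mul_zero]
      ηη := hf.ηη }
  rw [← add_eq_zero_iff_eq_neg]
  refine hframe.eq_zero ?_ ?_ ?_ ?_
  · rw [← lor4_horizontal]
    exact hsum _ hn (by rw [lor4_horizontal]; exact hf.bn)
  · exact hsum a ha (by rw [lor4_comm]; exact hf.ab)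
  · rw [hxν, Prod.fst_add, lor3_add_left, lor3_reflection_geodesicNormal]; ring
  · exact hsum η hη hf.bη

end

theorem immersion_of_conformal {D : Set ℂ} {ψ : ℂ → L4} {z : ℂ} {lam : ℝ} (hlam : 0 < lam)
    (h : ∀ v : ℂ, lor4 (fderivWithin ℝ ψ D z v) (fderivWithin ℝ ψ D z v) = lam * ‖v‖ ^ 2) :
    Function.Injective (fderivWithin ℝ ψ D z) := by
  refine (injective_iff_map_eq_zero _).2 fun v hv => ?_
  have h1 := h v
  rw [hv] at h1
  have h2 : lam * ‖v‖ ^ 2 = 0 := by rw [← h1]; simp [lor4, lor3]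
  simpa [hlam.ne'] using h2

/-! ### Compatibility of the 2-jet with the reflection along the axis -/

section

variable {Ω : Set ℂ} {p w : L3} {ψ η : ℂ → L4}

/-- At the points of the plane, the surface is reversed in the normal direction. -/
theorem reflection_fderivWithin_I (hΩ : IsOpen Ω) (hpw : IsUnitTangent p w)
    (hψ2 : ContDiffOn ℝ 2 ψ (upperPart Ω)) (hψ : IsConformalImmersionOn (upperPart Ω) ψ)
    (hη : IsUnitNormalOn (upperPart Ω) ψ η)
    (hplane : ∀ z ∈ Ω, z.im = 0 → ψ z ∈ verticalPlane p w)
    (horth : ∀ z ∈ Ω, z.im = 0 → η z ∈ verticalPlaneTangent p w (ψ z))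
    {z : ℂ} (hz : z ∈ Ω) (h : z.im = 0) :
    reflection p w (fderivWithin ℝ ψ (upperPart Ω) z Complex.I)
      = -fderivWithin ℝ ψ (upperPart Ω) z Complex.I := by
  have hzD : z ∈ upperPart Ω := ⟨hz, h.ge⟩
  have hψd := hψ2.differentiableOn two_ne_zero
  obtain ⟨r, hr⟩ := hplane z hz h
  refine reflection_eq_neg hpw (isConformalFrame (uniqueDiffOn_upperPart hΩ) hψd hψ hη hzD)
    (reflection_eq_self hpw (a := Real.cosh r) (b := Real.sinh r) hr.symm) ?_
    (reflection_of_mem_verticalPlaneTangent hpw (horth z hz h))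
  exact map_fderivWithin_one (τ := reflectionL p w) hΩ
    (fun z hz h => reflection_of_mem_verticalPlane hpw (hplane z hz h)) hz h (hψd z hzD)

/-- The mean curvature equation gives the compatibility condition for `ψ_tt` on the plane. -/
theorem reflection_fderivWithin_I_I (hΩ : IsOpen Ω) (hpw : IsUnitTangent p w)
    (hψ2 : ContDiffOn ℝ 2 ψ (upperPart Ω)) (hψ : IsConformalImmersionOn (upperPart Ω) ψ)
    (hη : IsUnitNormalOn (upperPart Ω) ψ η)
    (hH : ∀ z ∈ upperPart Ω, meanCurvature (upperPart Ω) ψ η z = 1 / 2)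
    (hplane : ∀ z ∈ Ω, z.im = 0 → ψ z ∈ verticalPlane p w)
    (horth : ∀ z ∈ Ω, z.im = 0 → η z ∈ verticalPlaneTangent p w (ψ z))
    {z : ℂ} (hz : z ∈ Ω) (h : z.im = 0) :
    reflection p w
        (fderivWithin ℝ (fderivWithin ℝ ψ (upperPart Ω)) (upperPart Ω) z Complex.I Complex.I)
      = fderivWithin ℝ (fderivWithin ℝ ψ (upperPart Ω)) (upperPart Ω) z Complex.I Complex.I := by
  have hzD : z ∈ upperPart Ω := ⟨hz, h.ge⟩
  have hD := uniqueDiffOn_upperPart hΩ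
  have hψd := hψ2.differentiableOn two_ne_zero
  have hAd : DifferentiableOn ℝ (fderivWithin ℝ ψ (upperPart Ω)) (upperPart Ω) :=
    (hψ2.fderivWithin hD (m := 1) (by norm_num)).differentiableOn one_ne_zero
  have h0 : ∀ z ∈ Ω, z.im = 0 → reflectionL p w (ψ z) = ψ z := fun z hz h =>
    reflection_of_mem_verticalPlane hpw (hplane z hz h)
  have hA : ∀ z ∈ Ω, z.im = 0 → conjAction (reflectionL p w) (fderivWithin ℝ ψ (upperPart Ω) z)
      = fderivWithin ℝ ψ (upperPart Ω) z := fun z hz h =>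
    conjAction_eq_of (map_fderivWithin_one hΩ h0 hz h (hψd z ⟨hz, h.ge⟩))
      (reflection_fderivWithin_I hΩ hpw hψ2 hψ hη hplane horth hz h)
  have h11 := DFunLike.congr_fun (map_fderivWithin_one hΩ hA hz h (hAd z hzD)) 1
  rw [conjAction_apply, map_one (starRingEnd ℂ)] at h11
  have hL := laplacian_eq hD (upperPart_subset_closure_interior hΩ) hψ2 hψ hη hzD (hH z hzD)
  obtain ⟨r, hr⟩ := hplane z hz h
  have hn : reflectionL p w ((ψ z).1, 0) = ((ψ z).1, 0) :=
    reflection_eq_self hpw (a := Real.cosh r) (b := Real.sinh r) hr.symm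
  have hηz : reflectionL p w (η z) = η z :=
    reflection_of_mem_verticalPlaneTangent hpw (horth z hz h)
  -- Solve the equation for `ψ_tt`: what remains is a combination of `η`, `(N, 0)` and `ψ_ss`, each
  -- fixed by the reflection.
  rw [← reflectionL_apply, eq_sub_of_add_eq' hL, map_sub, map_add, map_smul, map_smul, hn, hηz, h11]

end

end H2R

end

/-! ### The reflection principle -/

theorem mainTheorem10
    (Ω : Set ℂ) (hΩ_open : IsOpen Ω) (hΩ_conn : IsConnected Ω)
    (hΩ_symm : ∀ z ∈ Ω, starRingEnd ℂ z ∈ Ω)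
    (p w : H2R.L3) (hpw : H2R.IsUnitTangent p w)
    (ψ η : ℂ → H2R.L4)
    (hψ_C2 : ContDiffOn ℝ 2 ψ (H2R.upperPart Ω))
    (hψ_conf : H2R.IsConformalImmersionOn (H2R.upperPart Ω) ψ)
    (hη : H2R.IsUnitNormalOn (H2R.upperPart Ω) ψ η)
    (hH : ∀ z ∈ H2R.upperPart Ω, H2R.meanCurvature (H2R.upperPart Ω) ψ η z = 1 / 2)
    (hreg : H2R.HasRegularVerticalProjectionOn (H2R.upperPart Ω) ψ)
    (hplane : ∀ z ∈ Ω, z.im = 0 → ψ z ∈ H2R.verticalPlane p w)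
    (horth : ∀ z ∈ Ω, z.im = 0 → η z ∈ H2R.verticalPlaneTangent p w (ψ z)) :
    ContDiffOn ℝ ∞ (H2R.reflectedExtension p w ψ) Ω ∧
    H2R.IsConformalImmersionOn Ω (H2R.reflectedExtension p w ψ) ∧
    (∃ η' : ℂ → H2R.L4,
      H2R.IsUnitNormalOn Ω (H2R.reflectedExtension p w ψ) η' ∧
      Set.EqOn η' η (H2R.upperPart Ω) ∧
      ∀ z ∈ Ω, H2R.meanCurvature Ω (H2R.reflectedExtension p w ψ) η' z = 1 / 2) ∧
    Set.EqOn (H2R.reflectedExtension p w ψ) ψ (H2R.upperPart Ω) ∧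
    (∀ z ∈ Ω, H2R.reflectedExtension p w ψ (starRingEnd ℂ z)
      = H2R.reflection p w (H2R.reflectedExtension p w ψ z)) := by
  open H2R in
  set σ := reflectionL p w with hσ
  set D := upperPart Ω with hDdef
  have h0 : ∀ z ∈ Ω, z.im = 0 → σ (ψ z) = ψ z := fun z hz h =>
    reflection_of_mem_verticalPlane hpw (hplane z hz h)
  have hη0 : ∀ z ∈ Ω, z.im = 0 → σ (η z) = η z := fun z hz h =>
    reflection_of_mem_verticalPlaneTangent hpw (horth z hz h)
  obtain ⟨hd1, hd2, hC2⟩ := symmExtend_derivatives hΩ_open hΩ_symm (τ := σ) hψ_C2 h0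
    (fun z hz h => reflection_fderivWithin_I hΩ_open hpw hψ_C2 hψ_conf hη hplane horth hz h)
    (fun z hz h => reflection_fderivWithin_I_I hΩ_open hpw hψ_C2 hψ_conf hη hH hplane horth hz h)
  have hext : reflectedExtension p w ψ = symmExtend σ ψ := rfl
  rw [hext]
  have hD1 : ∀ z ∈ Ω, fderivWithin ℝ (symmExtend σ ψ) Ω z
      = symmExtend (conjAction σ) (fderivWithin ℝ ψ D) z := fun z hz => by
    rw [fderivWithin_of_isOpen hΩ_open hz, (hd1 z hz).fderiv]
  have hD2 : ∀ z ∈ Ω, fderivWithin ℝ (fderivWithin ℝ (symmExtend σ ψ) Ω) Ω z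
      = symmExtend (conjAction (conjAction σ)) (fderivWithin ℝ (fderivWithin ℝ ψ D) D) z :=
    fun z hz => by
      rw [fderivWithin_congr hD1 (hD1 z hz), fderivWithin_of_isOpen hΩ_open hz, (hd2 z hz).fderiv]
  have hmem : ∀ z ∈ Ω, z.im < 0 → starRingEnd ℂ z ∈ D := fun z hz h =>
    conj_mem_upperPart hΩ_symm hz h.le
  -- first derivatives and second derivatives on the two sides
  have hup1 : ∀ z ∈ Ω, 0 ≤ z.im → fderivWithin ℝ (symmExtend σ ψ) Ω z = fderivWithin ℝ ψ D z :=
    fun z hz h => by rw [hD1 z hz, symmExtend_of_nonneg _ _ h]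
  have hup2 : ∀ z ∈ Ω, 0 ≤ z.im → fderivWithin ℝ (fderivWithin ℝ (symmExtend σ ψ) Ω) Ω z
      = fderivWithin ℝ (fderivWithin ℝ ψ D) D z :=
    fun z hz h => by rw [hD2 z hz, symmExtend_of_nonneg _ _ h]
  have hlow1 : ∀ z ∈ Ω, z.im < 0 → ∀ v, fderivWithin ℝ (symmExtend σ ψ) Ω z v
      = reflection p w (fderivWithin ℝ ψ D (starRingEnd ℂ z) (starRingEnd ℂ v)) :=
    fun z hz h v => by rw [hD1 z hz, symmExtend_of_neg _ _ h]; rfl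
  have hlow2 : ∀ z ∈ Ω, z.im < 0 → ∀ v u,
      fderivWithin ℝ (fderivWithin ℝ (symmExtend σ ψ) Ω) Ω z v u
      = reflection p w (fderivWithin ℝ (fderivWithin ℝ ψ D) D (starRingEnd ℂ z)
        (starRingEnd ℂ v) (starRingEnd ℂ u)) :=
    fun z hz h v u => by rw [hD2 z hz, symmExtend_of_neg _ _ h]; rfl
  have hψlow : ∀ z : ℂ, z.im < 0 → symmExtend σ ψ z = reflection p w (ψ (starRingEnd ℂ z)) :=
    fun z h => symmExtend_of_neg _ _ h
  have hηlow : ∀ z : ℂ, z.im < 0 → symmExtend σ η z = reflection p w (η (starRingEnd ℂ z)) :=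
    fun z h => symmExtend_of_neg _ _ h
  have hconf : IsConformalImmersionOn Ω (symmExtend σ ψ) := by
    have hc : ∀ z ∈ Ω, ∃ lam : ℝ, 0 < lam ∧ ∀ v : ℂ,
        lor4 (fderivWithin ℝ (symmExtend σ ψ) Ω z v) (fderivWithin ℝ (symmExtend σ ψ) Ω z v)
          = lam * ‖v‖ ^ 2 := fun z hz => by
      rcases le_or_gt 0 z.im with h | h
      · rw [hup1 z hz h]
        exact hψ_conf.conformal z ⟨hz, h⟩
      · obtain ⟨lam, hpos, hl⟩ := hψ_conf.conformal _ (hmem z hz h)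
        refine ⟨lam, hpos, fun v => ?_⟩
        rw [hlow1 z hz h, lor4_reflection hpw, hl, RCLike.norm_conj]
    refine ⟨fun z hz => ?_, fun z hz => ?_, hc⟩
    · rcases le_or_gt 0 z.im with h | h
      · rw [symmExtend_of_nonneg _ _ h]
        exact hψ_conf.mapsTo ⟨hz, h⟩
      · rw [hψlow z h]
        exact reflection_mem_space hpw (hψ_conf.mapsTo (hmem z hz h))
    · obtain ⟨lam, hpos, hl⟩ := hc z hz
      exact immersion_of_conformal hpos hl
  have hnormal : IsUnitNormalOn Ω (symmExtend σ ψ) (symmExtend σ η) := by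
    refine ⟨continuousOn_symmExtend hΩ_symm hη.continuousOn hη0, fun z hz => ?_, fun z hz => ?_,
      fun z hz v => ?_⟩
    · rcases le_or_gt 0 z.im with h | h
      · rw [symmExtend_of_nonneg _ _ h, symmExtend_of_nonneg _ _ h]
        exact hη.tangent z ⟨hz, h⟩
      · rw [hψlow z h, hηlow z h, lor3_reflection hpw]
        exact hη.tangent _ (hmem z hz h)
    · rcases le_or_gt 0 z.im with h | h
      · rw [symmExtend_of_nonneg _ _ h]
        exact hη.unit z ⟨hz, h⟩
      · rw [hηlow z h, lor4_reflection hpw]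
        exact hη.unit _ (hmem z hz h)
    · rcases le_or_gt 0 z.im with h | h
      · rw [symmExtend_of_nonneg _ _ h, hup1 z hz h]
        exact hη.normal z ⟨hz, h⟩ v
      · rw [hηlow z h, hlow1 z hz h, lor4_reflection hpw]
        exact hη.normal _ (hmem z hz h) _
  have hmean : ∀ z ∈ Ω, meanCurvature Ω (symmExtend σ ψ) (symmExtend σ η) z = 1 / 2 :=
    fun z hz => by
      rcases le_or_gt 0 z.im with h | h
      · rw [← hH z ⟨hz, h⟩]
        simp only [meanCurvature, firstForm, secondForm, hup1 z hz h, hup2 z hz h,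
          symmExtend_of_nonneg _ _ h]
      · rw [← hH _ (hmem z hz h)]
        have hneg : ∀ x y : L4, lor4 (-x) y = -lor4 x y := fun x y => by
          simp [lor4, lor3]; ring
        have hneg' : ∀ x y : L4, lor4 x (-y) = -lor4 x y := fun x y => by
          simp [lor4, lor3]; ring
        -- Conjugation replaces `I` by `-I`. The `(I, I)` entries do not change, and the mixed
        -- entries of both forms change sign, but in the mean curvature these occur only as a
        -- product or a square.
        simp only [meanCurvature, firstForm, secondForm, hlow1 z hz h, hlow2 z hz h, hηlow z h,
          lor4_reflection hpw, map_one, Complex.conj_I, map_neg, neg_apply, neg_neg, hneg, hneg',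
          mul_neg, neg_mul, neg_sq]
  refine ⟨contDiffOn_infty_of_meanCurvature hΩ_open hC2 hconf hnormal hmean, hconf,
    ⟨symmExtend σ η, hnormal, fun z hz => symmExtend_of_nonneg _ _ hz.2, hmean⟩,
    fun z hz => symmExtend_of_nonneg _ _ hz.2, fun z hz => ?_⟩
  rcases lt_trichotomy z.im 0 with h | h | h
  · rw [hψlow z h, reflection_reflection hpw,
      symmExtend_of_nonneg _ _ (by rw [Complex.conj_im]; linarith)]
  · rw [Complex.conj_eq_iff_im.2 h, symmExtend_of_nonneg _ _ h.ge]
    exact (h0 z hz h).symm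
  · rw [hψlow _ (by rw [Complex.conj_im]; linarith), Complex.conj_conj,
      symmExtend_of_nonneg _ _ h.le]
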